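/- Let $n\ge 2$ and let $(d_2,\dots,d_n)$ be positive integers with $d_j\mid d_{j+1}$ and $d_n>1$. Let $E=\mathbb C/(d_n\pi i\,\mathbb Z+d_n\mathbb Z)$ and let $P\in E$ be the image of $1$. Let $F=\mathbb C/(\tau_F\mathbb Z+\mathbb Z)$, $\operatorname{Im}\tau_F>0$, be an elliptic curve with complex multiplication (for example $\tau_F=i$). Let $B=\prod_{j=2}^n\mathbb C/(t_j\mathbb Z+d_j\mathbb Z)$, where either $t_j=\tau_F$ for all $j$, or $t_j=d_j\tau_F$ for all $j$ (in the second case $B\cong F^{n-1}$), and let $Q\in B$ be the image of $-e_n$, where $e_2,\dots,e_n$ is the standard basis of $\mathbb C^{n-1}$. Then $P$ and $Q$ have order $d_n$; the Hermitian form $H_B(v,w)=\sum_j v_j\overline{w_j}/\operatorname{Im}t_j$ is a (product) polarisation of type $(d_2,\dots,d_n)$ on $B$, and $Q$ lies in the kernel of the polarising isogeny $\varphi_{H_B}$. Let $$A=(E\times B)/\langle(P,Q)\rangle .$$ 1. The Hermitian form $H\big((z,v),(z',v')\big)=z\overline{z'}/(d_n\pi)+H_B(v,v')$ is a polarisation of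 type $(1,d_2,\dots,d_n)$ on the $n$-dimensional complex torus $A$. With $\tau_E=\pi i$, the polarised abelian variety $(A,H)$ has the big period matrix $[Z\ D]$, $D=\operatorname{diag}(1,d_2,\dots,d_n)$, where $Z=\operatorname{diag}(d_n\tau_E,t_2,\dots,t_n)+d_n\tau_E(E_{1n}+E_{n1}+E_{nn})$ and $E_{kl}$ are the matrix units; that is, $Z$ is symmetric, $\operatorname{Im}Z>0$, and in a suitable basis of $\mathbb C^n$ the columns of $[Z\ D]$ generate the lattice of $A$ and $H$ has the matrix $(\operatorname{Im}Z)^{-1}$. 2. $A$ is not isomorphic to its dual abelian variety $\hat A$. 3. The Picard number of $A$ is $(n-1)^2+1$. -/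

import Mathlib

open scoped Topology ComplexConjugate

noncomputable section

/-! Complex tori `V ⧸ Λ`, where `V` is a finite dimensional complex vector space and `Λ` a lattice. -/

section Tori

variable {V W : Type*} [NormedAddCommGroup V] [NormedSpace ℂ V]
  [NormedAddCommGroup W] [NormedSpace ℂ W]

/-- `Λ` is a (full) lattice in `V`: a discrete subgroup that spans `V` over `ℝ`. -/
def IsFullLattice (Λ : AddSubgroup V) : Prop :=
  DiscreteTopology Λ ∧ Submodule.span ℝ (Λ : Set V) = ⊤

/-- A group homomorphism `V ⧸ Λ → W ⧸ Λ'` is holomorphic if, near each point, it lifts to a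
holomorphic map `V → W` (the projections `V → V ⧸ Λ` being the charts of the torus). -/
def IsHolomorphicHom {Λ : AddSubgroup V} {Λ' : AddSubgroup W} (f : V ⧸ Λ →+ W ⧸ Λ') : Prop :=
  ∀ v : V, ∃ U ∈ 𝓝 v, ∃ g : V → W, DifferentiableOn ℂ g U ∧
    ∀ x ∈ U, f (QuotientAddGroup.mk x) = QuotientAddGroup.mk (g x)

/-- The complex tori `V ⧸ Λ` and `W ⧸ Λ'` are isomorphic: there is a biholomorphic group
isomorphism between them. -/
def TorusIso (Λ : AddSubgroup V) (Λ' : AddSubgroup W) : Prop :=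
  ∃ f : V ⧸ Λ ≃+ W ⧸ Λ', IsHolomorphicHom f.toAddMonoidHom ∧
    IsHolomorphicHom f.symm.toAddMonoidHom

/-- The elliptic curve `ℂ ⧸ Λ` has complex multiplication: it has an endomorphism that is not
multiplication by an integer. -/
def HasCM (Λ : AddSubgroup ℂ) : Prop :=
  ∃ f : ℂ ⧸ Λ →+ ℂ ⧸ Λ, IsHolomorphicHom f ∧ ∀ k : ℤ, f ≠ k • AddMonoidHom.id (ℂ ⧸ Λ)

/-- The lattice of the quotient torus `(V ⧸ Λ) ⧸ G`, i.e. the preimage of `G` in `V`. -/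
def quotientLattice (Λ : AddSubgroup V) (G : AddSubgroup (V ⧸ Λ)) : AddSubgroup V :=
  G.comap (QuotientAddGroup.mk' Λ)

/-- The lattice of the dual torus: the antilinear forms on `V` whose imaginary part is integral on
`Λ`. The dual torus is `(V →L⋆[ℂ] ℂ) ⧸ dualLattice Λ`. -/
def dualLattice (Λ : AddSubgroup V) : AddSubgroup (V →L⋆[ℂ] ℂ) where
  carrier := {l | ∀ x ∈ Λ, ∃ k : ℤ, (l x).im = k}
  zero_mem' := fun x _ => ⟨0, by simp⟩
  add_mem' := by
    intro a b ha hb x hx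
    obtain ⟨k, hk⟩ := ha x hx
    obtain ⟨l, hl⟩ := hb x hx
    exact ⟨k + l, by simp [hk, hl]⟩
  neg_mem' := by
    intro a ha x hx
    obtain ⟨k, hk⟩ := ha x hx
    exact ⟨-k, by simp [hk]⟩

/-- The Néron–Severi group of `V ⧸ Λ`: the Hermitian forms (linear in the first variable, antilinear
in the second) whose imaginary part is integral on `Λ`. -/
def neronSeveri (Λ : AddSubgroup V) : AddSubgroup (V →L[ℂ] V →L⋆[ℂ] ℂ) where
  carrier := {H | (∀ v w, H w v = conj (H v w)) ∧
    ∀ x ∈ Λ, ∀ y ∈ Λ, ∃ k : ℤ, (H x y).im = k}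
  zero_mem' := ⟨fun v w => by simp, fun x _ y _ => ⟨0, by simp⟩⟩
  add_mem' := by
    intro a b ha hb
    refine ⟨fun v w => by simp [ha.1 v w, hb.1 v w], fun x hx y hy => ?_⟩
    obtain ⟨k, hk⟩ := ha.2 x hx y hy
    obtain ⟨l, hl⟩ := hb.2 x hx y hy
    exact ⟨k + l, by simp [hk, hl]⟩
  neg_mem' := by
    intro a ha
    refine ⟨fun v w => by simp [ha.1 v w], fun x hx y hy => ?_⟩
    obtain ⟨k, hk⟩ := ha.2 x hx y hy
    exact ⟨-k, by simp [hk]⟩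

/-- The Picard number of `V ⧸ Λ`, the rank of its Néron–Severi group. -/
def picardNumber (Λ : AddSubgroup V) : ℕ := Module.finrank ℤ (neronSeveri Λ)

/-- The homomorphism `φ_H` from `V ⧸ Λ` to its dual, `v ↦ H(v, ·)`. -/
def polarisingHom {Λ : AddSubgroup V} (H : neronSeveri Λ) :
    V ⧸ Λ →+ (V →L⋆[ℂ] ℂ) ⧸ dualLattice Λ :=
  QuotientAddGroup.map Λ (dualLattice Λ)
    (H : V →L[ℂ] V →L⋆[ℂ] ℂ).toLinearMap.toAddMonoidHom
    (fun x hx y hy => H.2.2 x hx y hy)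

/-- `H` is a polarisation of type `(d₁, …, dₙ)` on the `n`-dimensional torus `V ⧸ Λ`: it is positive
definite, and the kernel of `φ_H` is isomorphic to `(ℤ/d₁ × ⋯ × ℤ/dₙ)²`, where the `dᵢ` are positive
and each divides the following ones. -/
def IsPolarisationOfType {Λ : AddSubgroup V} (H : neronSeveri Λ) {n : ℕ} (d : Fin n → ℕ) : Prop :=
  Module.finrank ℂ V = n ∧
  (∀ v : V, v ≠ 0 → 0 < ((H : V →L[ℂ] V →L⋆[ℂ] ℂ) v v).re) ∧
  (∀ i, 0 < d i) ∧ (∀ i j, i ≤ j → d i ∣ d j) ∧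
  Nonempty ((polarisingHom H).ker ≃+ (((i : Fin n) → ZMod (d i)) × ((i : Fin n) → ZMod (d i))))

/-- `[Z D]`, with `D = diag(d₁, …, dₙ)`, is a big period matrix of the polarised torus
`(V ⧸ Λ, H)`: `Z` is in the Siegel upper half space and, in a suitable basis of `V`, the columns of
`[Z D]` generate `Λ` and `H` has the matrix `(Im Z)⁻¹`. -/
def IsBigPeriodMatrix {Λ : AddSubgroup V} (H : neronSeveri Λ) {n : ℕ}
    (Z : Matrix (Fin n) (Fin n) ℂ) (d : Fin n → ℕ) : Prop :=
  Z.IsSymm ∧ (Z.map Complex.im).PosDef ∧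
  ∃ b : Module.Basis (Fin n) ℂ V,
    Λ = AddSubgroup.closure
      (Set.range (fun j => ∑ i, Z i j • b i) ∪ Set.range (fun j => (d j : ℂ) • b j)) ∧
    ∀ i j, (H : V →L[ℂ] V →L⋆[ℂ] ℂ) (b i) (b j) = (((Z.map Complex.im)⁻¹ i j : ℝ) : ℂ)

end Tori

/-! The construction. Here `n = m + 2`, and `d : Fin (m + 1) → ℕ` stands for `(d₂, …, dₙ)`, so that
`dₙ = d (Fin.last m)`. -/

/-- The lattice `ωℤ + ηℤ` in `ℂ`. -/
def planeLattice (ω η : ℂ) : AddSubgroup ℂ := AddSubgroup.closure {ω, η}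

/-- The lattice of `E`, generated by `dₙπi` and `dₙ`. -/
def latticeE (N : ℕ) : AddSubgroup ℂ := planeLattice (N * (Real.pi * Complex.I)) N

/-- The lattice of the product `B` of the curves `ℂ ⧸ (tⱼℤ + dⱼℤ)`. -/
def latticeB {m : ℕ} (d : Fin (m + 1) → ℕ) (t : Fin (m + 1) → ℂ) :
    AddSubgroup (Fin (m + 1) → ℂ) :=
  AddSubgroup.pi Set.univ (fun j => planeLattice (t j) (d j))

/-- The lattice of `A = (E × B) ⧸ ⟨(P, Q)⟩`, where `P` is the image of `1` and `Q` that of `-eₙ`,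
the negative of the last basis vector. -/
def latticeA {m : ℕ} (d : Fin (m + 1) → ℕ) (t : Fin (m + 1) → ℂ) :
    AddSubgroup (ℂ × (Fin (m + 1) → ℂ)) :=
  quotientLattice ((latticeE (d (Fin.last m))).prod (latticeB d t))
    (AddSubgroup.zmultiples (QuotientAddGroup.mk (1, -Pi.single (Fin.last m) 1)))

/-- The small period matrix of `A`: the diagonal matrix with entries `a, t₂, …, tₙ`, with `a` added at
the positions `(1, n)`, `(n, 1)` and `(n, n)`; it is used for `a = dₙπi`. -/
def smallPeriodMatrix {m : ℕ} (a : ℂ) (t : Fin (m + 1) → ℂ) :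
    Matrix (Fin (m + 2)) (Fin (m + 2)) ℂ :=
  Matrix.diagonal (Fin.cons a t) + Matrix.single 0 (Fin.last (m + 1)) a
    + Matrix.single (Fin.last (m + 1)) 0 a
    + Matrix.single (Fin.last (m + 1)) (Fin.last (m + 1)) a

end

/-! Everything in part 1 is read off from a real basis of the lattice that is symplectic for `Im H`.
If `Im H(lᵢ, mⱼ) = dᵢ δᵢⱼ` and the `lᵢ`, and likewise the `mᵢ`, are isotropic, then pairing with the
basis recovers the coordinates of a vector up to the factors `dᵢ`. This gives discreteness,
integrality and the kernel of `φ_H`, which consists of the points with coordinates in `dᵢ⁻¹ℤ` modulo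
`ℤ`. If moreover `mⱼ = dⱼ bⱼ` for a complex basis `b` in which `H` is real, the pairing says `Im Z ·
H = 1`, so `[Z D]` is a big period matrix.

Parts 2 and 3 rest on the arithmetic fact that `E` and `F` are not isogenous. By complex
multiplication `τ_F` lies in `ℚ + ℚyi` with `y²` rational, while the periods of `E` lie in `ℚ +
ℚπi`. A nonzero homomorphism between the two curves would make `π²` rational, which Cartwright's
integrals exclude; the same fact shows that `E` has no complex multiplication.

For part 2, `A` contains `E` as the curve `{(z, 0)}`, with lattice `dₙπiℤ + dₙℤ`. Its dual contains
the curve dual to the quotient `A → E/⟨P⟩`, with lattice `dₙπiℤ + ℤ` up to scaling. A holomorphic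
isomorphism lifts to a linear map (`IsHolomorphicHom.exists_lift`), which has to carry the second
curve onto the first because there are no homomorphisms to `B`. It does so by multiplication by an
integer divisible by `dₙ`, which cannot be an isomorphism when `dₙ > 1`.

For part 3, cross terms between `E` and `B` vanish in every Néron–Severi class. What remains is one
rational parameter for `E` and a rational Hermitian form on the factors of `B`, with `(n - 1)²`
rational parameters. Conversely every such form has an integral multiple, so the rank is the
dimension of this rational space. -/

noncomputable section

/-! ### Irrationality of `π ^ 2`, by Cartwright's integrals -/

section PiSquared

open intervalIntegral MeasureTheory.MeasureSpace Real
open scoped Nat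

/-- The integrals `∫ x in (-1)..1, (1 - x ^ 2) ^ n * cos (x * θ)`. -/
def cartwrightIntegral (n : ℕ) (θ : ℝ) : ℝ := ∫ x in (-1)..1, (1 - x ^ 2) ^ n * cos (x * θ)

lemma cartwrightIntegral_zero (θ : ℝ) : cartwrightIntegral 0 θ * θ = 2 * sin θ := by
  rw [mul_comm, cartwrightIntegral]
  simp [mul_integral_comp_mul_right, two_mul]

/-- Two integrations by parts, applied to `(1 - x²)ⁿ⁺¹` and then to `x(1 - x²)ⁿ`. The second
boundary term survives only for `n = 0`, hence the factor `0 ^ n`; the truncated index `n - 1` is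
harmless there because its coefficient vanishes. -/
lemma cartwrightIntegral_succ (n : ℕ) (θ : ℝ) :
    cartwrightIntegral (n + 1) θ * θ ^ 2 = - (2 * 2 * ((n + 1) * (0 ^ n * cos θ))) +
      2 * (n + 1) * (2 * n + 1) * cartwrightIntegral n θ
        - 4 * (n + 1) * n * cartwrightIntegral (n - 1) θ := by
  rw [cartwrightIntegral]
  let f (x : ℝ) : ℝ := 1 - x ^ 2
  let u₁ (x : ℝ) : ℝ := f x ^ (n + 1)
  let u₁' (x : ℝ) : ℝ := - (2 * (n + 1) * x * f x ^ n)
  let v₁ (x : ℝ) : ℝ := sin (x * θ)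
  let v₁' (x : ℝ) : ℝ := cos (x * θ) * θ
  let u₂ (x : ℝ) : ℝ := x * (f x) ^ n
  let u₂' (x : ℝ) : ℝ := (f x) ^ n - 2 * n * x ^ 2 * (f x) ^ (n - 1)
  let v₂ (x : ℝ) : ℝ := cos (x * θ)
  let v₂' (x : ℝ) : ℝ := -sin (x * θ) * θ
  have hfd : Continuous f := by fun_prop
  have hu₁d : Continuous u₁' := by fun_prop
  have hv₁d : Continuous v₁' := by fun_prop
  have hu₂d : Continuous u₂' := by fun_prop
  have hv₂d : Continuous v₂' := by fun_prop
  have hu₁_eval_one : u₁ 1 = 0 := by simp only [u₁, f]; simp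
  have hu₁_eval_neg_one : u₁ (-1) = 0 := by simp only [u₁, f]; simp
  have t : u₂ 1 * v₂ 1 - u₂ (-1) * v₂ (-1) = 2 * (0 ^ n * cos θ) := by simp [u₂, v₂, f, ← two_mul]
  have hf (x) : HasDerivAt f (- 2 * x) x := by
    convert! (hasDerivAt_pow 2 x).const_sub 1 using 1
    simp
  have hu₁ (x) : HasDerivAt u₁ (u₁' x) x := by
    convert! (hf x).pow _ using 1
    simp only [Nat.add_succ_sub_one, u₁', Nat.cast_add_one]
    ring
  have hv₁ (x) : HasDerivAt v₁ (v₁' x) x := (hasDerivAt_mul_const θ).sin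
  have hu₂ (x) : HasDerivAt u₂ (u₂' x) x := by
    convert! (hasDerivAt_id' x).fun_mul ((hf x).fun_pow _) using 1
    simp only [u₂']
    ring
  have hv₂ (x) : HasDerivAt v₂ (v₂' x) x := (hasDerivAt_mul_const θ).cos
  convert_to (∫ (x : ℝ) in (-1)..1, u₁ x * v₁' x) * θ = _ using 1
  · simp_rw [u₁, v₁', f, ← intervalIntegral.integral_mul_const, sq θ, mul_assoc]
  rw [integral_mul_deriv_eq_deriv_mul (fun x _ => hu₁ x) (fun x _ => hv₁ x)
    (hu₁d.intervalIntegrable _ _) (hv₁d.intervalIntegrable _ _), hu₁_eval_one, hu₁_eval_neg_one,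
    zero_mul, zero_mul, sub_zero, zero_sub, ← integral_neg, ← integral_mul_const]
  convert_to ((-2 : ℝ) * (n + 1)) * ∫ (x : ℝ) in (-1)..1, (u₂ x * v₂' x) = _ using 1
  · rw [← integral_const_mul]
    congr 1 with x
    dsimp [u₁', v₁, u₂, v₂']
    ring
  rw [integral_mul_deriv_eq_deriv_mul (fun x _ => hu₂ x) (fun x _ => hv₂ x)
    (hu₂d.intervalIntegrable _ _) (hv₂d.intervalIntegrable _ _),
    mul_sub, t, neg_mul, neg_mul, neg_mul, sub_neg_eq_add]
  have (x : _) : u₂' x = (2 * n + 1) * f x ^ n - 2 * n * f x ^ (n - 1) := by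
    cases n with
    | zero => simp [u₂']
    | succ n => ring!
  simp_rw [this, sub_mul, mul_assoc _ _ (v₂ _)]
  have : Continuous v₂ := by fun_prop
  rw [mul_mul_mul_comm, integral_sub, mul_sub, add_sub_assoc]
  · congr 1
    simp_rw [integral_const_mul]
    ring!
  all_goals exact Continuous.intervalIntegrable (by fun_prop) _ _

lemma cartwrightIntegral_pos (n : ℕ) : 0 < cartwrightIntegral n (π / 2) := by
  refine integral_pos (by simp) (by fun_prop) ?_ ⟨0, by simp⟩
  refine fun x hx => mul_nonneg (pow_nonneg ?_ _) ?_
  · rw [sub_nonneg, sq_le_one_iff_abs_le_one, abs_le]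
    exact ⟨hx.1.le, hx.2⟩
  refine cos_nonneg_of_neg_pi_div_two_le_of_le ?_ ?_ <;>
  nlinarith [hx.1, hx.2, pi_pos]

lemma cartwrightIntegral_le (n : ℕ) : cartwrightIntegral n (π / 2) ≤ 2 := by
  rw [← norm_of_nonneg (cartwrightIntegral_pos n).le]
  refine (norm_integral_le_of_norm_le_const ?_).trans (show (1 : ℝ) * _ ≤ _ by norm_num)
  intro x hx
  simp only [Set.uIoc_of_le, neg_le_self_iff, zero_le_one, Set.mem_Ioc] at hx
  rw [norm_eq_abs, abs_mul, abs_pow]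
  refine mul_le_one₀ (pow_le_one₀ (abs_nonneg _) ?_) (abs_nonneg _) (abs_cos_le_one _)
  rw [abs_le]
  constructor <;> nlinarith

/-- After scaling by the odd power of `θ = π / 2`, the recursion involves `θ` only through `θ²`. A
denominator of `θ²` therefore suffices, and this is what yields irrationality of `π²` and not just
of `π`. -/
lemma exists_int_cartwrightIntegral {a : ℤ} {b : ℕ} (h : (π / 2) ^ 2 * b = a) :
    ∀ n : ℕ, ∃ z : ℤ, b ^ n * (cartwrightIntegral n (π / 2) * (π / 2) ^ (2 * n + 1)) = n ! * z
  | 0 => ⟨2, by simp [cartwrightIntegral_zero]⟩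
  | 1 => ⟨4 * b, by
      have h1 := cartwrightIntegral_succ 0 (π / 2)
      have h0 := cartwrightIntegral_zero (π / 2)
      simp only [cos_pi_div_two, sin_pi_div_two] at h0 h1
      push_cast at h1 ⊢
      simp only [Nat.factorial_one, Nat.cast_one]
      linear_combination (π / 2) * b * h1 + 2 * b * h0⟩
  | n + 2 => by
      obtain ⟨y, hy⟩ := exists_int_cartwrightIntegral h n
      obtain ⟨z, hz⟩ := exists_int_cartwrightIntegral h (n + 1)
      refine ⟨2 * (2 * n + 3) * b * z - 4 * a * b * y, ?_⟩
      have h1 := cartwrightIntegral_succ (n + 1) (π / 2)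
      rw [cos_pi_div_two] at h1
      simp only [Nat.factorial_succ, add_tsub_cancel_right] at h1 hz ⊢
      push_cast at h1 hz ⊢
      set θ := π / 2
      have e1 : (b : ℝ) ^ (n + 2) * (cartwrightIntegral (n + 2) θ * θ ^ (2 * (n + 2) + 1)) =
          b * b ^ (n + 1) * θ ^ (2 * (n + 1) + 1) * (cartwrightIntegral (n + 2) θ * θ ^ 2) := by
        ring
      rw [e1, h1]
      linear_combination 2 * (n + 2) * (2 * n + 3) * b * hz
        - 4 * (n + 2) * (n + 1) * b * (θ ^ 2 * b) * hy - 4 * (n + 2) * (n + 1) * b * n ! * y * h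

/-- If `(π / 2)² = a / b`, the integer `z` of `exists_int_cartwrightIntegral` is positive and at
most `π aⁿ / n!`, which is below `1` for some `n`. -/
theorem irrational_pi_sq : Irrational (π ^ 2) := by
  rintro ⟨r, hr⟩
  have hb : (0 : ℝ) < (r / 4).den := by exact_mod_cast (r / 4).den_pos
  have h : (π / 2) ^ 2 * ((r / 4).den : ℕ) = ((r / 4).num : ℤ) := by
    have := congrArg (fun q : ℚ => (q : ℝ)) (Rat.num_div_den (r / 4))
    push_cast at this
    rw [div_eq_iff hb.ne'] at this
    rw [this, div_pow, ← hr]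
    norm_num
  set a := (r / 4).num
  set b := (r / 4).den
  have lim := (FloorSemiring.tendsto_pow_div_factorial_atTop ((a : ℝ))).const_mul (π / 2 * 2)
  rw [mul_zero] at lim
  obtain ⟨n, hn⟩ := (lim.eventually_lt_const (zero_lt_one' ℝ)).exists
  obtain ⟨z, hz⟩ := exists_int_cartwrightIntegral h n
  have hI := cartwrightIntegral_pos n
  have hI2 := cartwrightIntegral_le n
  have hf : (0 : ℝ) < n ! := by positivity
  have hpi := pi_pos
  have hz0 : (0 : ℝ) < n ! * z := by rw [← hz]; positivity
  have e : (b : ℝ) ^ n * (cartwrightIntegral n (π / 2) * (π / 2) ^ (2 * n + 1)) =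
      π / 2 * cartwrightIntegral n (π / 2) * a ^ n := by
    rw [← h, mul_pow, ← pow_mul, pow_succ _ (2 * n)]; ring
  have hapos : (0 : ℝ) < a := by rw [← h]; positivity
  have hz1 : (n ! : ℝ) * z < n ! * 1 := by
    rw [← hz, e]
    rw [mul_div_assoc', div_lt_iff₀ hf, one_mul] at hn
    refine lt_of_le_of_lt ?_ (hn.trans_eq (mul_one _).symm)
    gcongr
  have h0 : (0 : ℝ) < z := pos_of_mul_pos_right hz0 hf.le
  have h1 : (z : ℝ) < 1 := lt_of_mul_lt_mul_left hz1 hf.le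
  have h0' : 0 < z := by exact_mod_cast h0
  have h1' : z < 1 := by exact_mod_cast h1
  omega

end PiSquared

end

noncomputable section

/-! ### Lattices with a symplectic frame -/

section Frames

variable {V : Type*} [NormedAddCommGroup V] [NormedSpace ℂ V]

lemma mem_closure_range_union {ι G : Type*} [Fintype ι] [AddCommGroup G] (l m : ι → G) (x : G) :
    x ∈ AddSubgroup.closure (Set.range l ∪ Set.range m) ↔
      ∃ p q : ι → ℤ, x = ∑ i, (p i • l i + q i • m i) := by
  rw [← Submodule.span_int_eq_addSubgroupClosure, Submodule.mem_toAddSubgroup,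
    Submodule.span_union, Submodule.mem_sup]
  simp only [Submodule.mem_span_range_iff_exists_fun, Finset.sum_add_distrib]
  constructor
  · rintro ⟨_, ⟨p, rfl⟩, _, ⟨q, rfl⟩, rfl⟩
    exact ⟨p, q, rfl⟩
  · rintro ⟨p, q, rfl⟩
    exact ⟨_, ⟨p, rfl⟩, _, ⟨q, rfl⟩, rfl⟩

lemma sum_zsmul_eq_sum_smul {ι : Type*} [Fintype ι] (l m : ι → V) (p q : ι → ℤ) :
    ∑ i, (p i • l i + q i • m i) =
    ∑ i, ((((p i : ℝ)) : ℂ) • l i + (((q i : ℝ)) : ℂ) • m i) := by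
  refine Finset.sum_congr rfl fun i _ => ?_
  rw [Complex.ofReal_intCast, Complex.ofReal_intCast, Int.cast_smul_eq_zsmul,
    Int.cast_smul_eq_zsmul]

/-- The homomorphism `ℤⁿ × ℤⁿ → V ⧸ Λ` with image the kernel of the polarising isogeny. -/
def kernelParam {ι : Type*} [Fintype ι] (d : ι → ℕ) (l m : ι → V) (Λ : AddSubgroup V) :
    (ι → ℤ) × (ι → ℤ) →+ V ⧸ Λ :=
  (QuotientAddGroup.mk' Λ).comp
    { toFun := fun p => ∑ i, (((p.1 i / d i : ℝ) : ℂ) • l i + ((p.2 i / d i : ℝ) : ℂ) • m i)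
      map_zero' := by simp
      map_add' := fun p q => by
        rw [← Finset.sum_add_distrib]
        refine Finset.sum_congr rfl fun i _ => ?_
        simp only [Prod.fst_add, Prod.snd_add, Pi.add_apply]
        push_cast
        module }

/-- The reduction `ℤⁿ × ℤⁿ → ∏ ℤ/dᵢ × ∏ ℤ/dᵢ`. -/
def reductionHom {ι : Type*} (d : ι → ℕ) :
    (ι → ℤ) × (ι → ℤ) →+ ((i : ι) → ZMod (d i)) × ((i : ι) → ZMod (d i)) where
  toFun p := (fun i => (p.1 i : ZMod (d i)), fun i => (p.2 i : ZMod (d i)))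
  map_zero' := by ext <;> simp
  map_add' p q := by ext <;> simp

lemma reductionHom_surjective {ι : Type*} (d : ι → ℕ) : Function.Surjective (reductionHom d) := by
  rintro ⟨a, b⟩
  choose p hp using fun i => ZMod.intCast_surjective (a i)
  choose q hq using fun i => ZMod.intCast_surjective (b i)
  exact ⟨(p, q), Prod.ext (funext hp) (funext hq)⟩

/-- The vectors `l i`, `m i` span `V` over `ℝ` and are symplectic, with elementary divisors `d i`,
for the imaginary part of the form `H`. -/
structure IsSymplecticFrame {ι : Type*} [Fintype ι] [DecidableEq ι]
    (H : V →L[ℂ] V →L⋆[ℂ] ℂ) (d : ι → ℕ) (l m : ι → V) : Prop where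
  pos : ∀ i, 0 < d i
  hermitian : ∀ v w, H w v = conj (H v w)
  left : ∀ i j, (H (l i) (l j)).im = 0
  right : ∀ i j, (H (m i) (m j)).im = 0
  pairing : ∀ i j, (H (l i) (m j)).im = if i = j then (d i : ℝ) else 0
  span : ∀ v, ∃ x y : ι → ℝ, v = ∑ i, ((x i : ℂ) • l i + (y i : ℂ) • m i)

namespace IsSymplecticFrame

variable {ι : Type*} [Fintype ι] [DecidableEq ι] {H : V →L[ℂ] V →L⋆[ℂ] ℂ} {d : ι → ℕ}
  {l m : ι → V}

/-- Since `d j` is nonzero, this and `im_sum_left` determine the coordinates; independence of the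
frame over `ℝ` need not be assumed. -/
lemma im_sum_right (S : IsSymplecticFrame H d l m) (x y : ι → ℝ) (j : ι) :
    (H (∑ i, ((x i : ℂ) • l i + (y i : ℂ) • m i)) (m j)).im = x j * d j := by
  simp [S.right, S.pairing]

lemma im_sum_left (S : IsSymplecticFrame H d l m) (x y : ι → ℝ) (j : ι) :
    (H (∑ i, ((x i : ℂ) • l i + (y i : ℂ) • m i)) (l j)).im = -(y j * d j) := by
  have h (i : ι) : (H (m i) (l j)).im = - if j = i then (d j : ℝ) else 0 := by
    rw [S.hermitian (l j) (m i), Complex.conj_im, S.pairing]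
  simp [S.left, h]

/-- Membership in the lattice of a frame, in terms of the real coordinates. -/
lemma mem_lattice_iff (S : IsSymplecticFrame H d l m) (x y : ι → ℝ) :
    ∑ i, ((x i : ℂ) • l i + (y i : ℂ) • m i) ∈
      AddSubgroup.closure (Set.range l ∪ Set.range m) ↔
      ∀ i, (∃ k : ℤ, x i = k) ∧ ∃ k : ℤ, y i = k := by
  rw [mem_closure_range_union]
  constructor
  · rintro ⟨p, q, h⟩ i
    rw [sum_zsmul_eq_sum_smul] at h
    have hd : (d i : ℝ) ≠ 0 := by exact_mod_cast (S.pos i).ne'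
    have h1 := S.im_sum_right x y i
    have h2 := S.im_sum_left x y i
    rw [h, S.im_sum_right] at h1
    rw [h, S.im_sum_left, neg_inj] at h2
    exact ⟨⟨p i, (mul_right_cancel₀ hd h1).symm⟩, ⟨q i, (mul_right_cancel₀ hd h2).symm⟩⟩
  · intro h
    choose p hp using fun i => (h i).1
    choose q hq using fun i => (h i).2
    refine ⟨p, q, ?_⟩
    rw [sum_zsmul_eq_sum_smul]
    simp only [hp, hq]

lemma mem_dualLattice_iff (S : IsSymplecticFrame H d l m) (x y : ι → ℝ) :
    H (∑ i, ((x i : ℂ) • l i + (y i : ℂ) • m i)) ∈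
      dualLattice (AddSubgroup.closure (Set.range l ∪ Set.range m)) ↔
      ∀ i, (∃ k : ℤ, x i * d i = k) ∧ ∃ k : ℤ, y i * d i = k := by
  constructor
  · intro h i
    obtain ⟨k, hk⟩ := h (m i) (AddSubgroup.subset_closure (Or.inr ⟨i, rfl⟩))
    obtain ⟨k', hk'⟩ := h (l i) (AddSubgroup.subset_closure (Or.inl ⟨i, rfl⟩))
    rw [S.im_sum_right] at hk
    rw [S.im_sum_left] at hk'
    exact ⟨⟨k, hk⟩, ⟨-k', by rw [Int.cast_neg, ← hk', neg_neg]⟩⟩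
  · intro h v hv
    induction hv using AddSubgroup.closure_induction with
    | mem v hv =>
      rcases hv with ⟨i, rfl⟩ | ⟨i, rfl⟩
      · obtain ⟨k, hk⟩ := (h i).2
        exact ⟨-k, by rw [S.im_sum_left, hk, Int.cast_neg]⟩
      · obtain ⟨k, hk⟩ := (h i).1
        exact ⟨k, by rw [S.im_sum_right, hk]⟩
    | zero => exact ⟨0, by simp⟩
    | add v w _ _ hv hw =>
      obtain ⟨k, hk⟩ := hv
      obtain ⟨k', hk'⟩ := hw
      exact ⟨k + k', by rw [map_add, Complex.add_im, hk, hk', Int.cast_add]⟩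
    | neg v _ hv =>
      obtain ⟨k, hk⟩ := hv
      exact ⟨-k, by rw [map_neg, Complex.neg_im, hk, Int.cast_neg]⟩

lemma isFullLattice (S : IsSymplecticFrame H d l m) :
    IsFullLattice (AddSubgroup.closure (Set.range l ∪ Set.range m)) := by
  constructor
  · apply discreteTopology_of_isOpen_singleton_zero
    -- On the lattice these imaginary parts are integers, so a lattice point in `U` has all pairings
    -- zero and hence all coordinates zero.
    let U : Set V := {v | ∀ i, |(H v (m i)).im| < 1 ∧ |(H v (l i)).im| < 1}
    have hc (w : V) : Continuous fun v => |(H v w).im| :=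
      (Complex.continuous_im.comp ((ContinuousLinearMap.apply' ℂ (starRingEnd ℂ) w).continuous.comp
        H.continuous)).abs
    have hU : IsOpen U := by
      have : U = ⋂ i, ({v | |(H v (m i)).im| < 1} ∩ {v | |(H v (l i)).im| < 1}) := by
        ext v; simp [U]
      rw [this]
      exact isOpen_iInter_of_finite fun i =>
        (isOpen_lt (hc _) continuous_const).inter (isOpen_lt (hc _) continuous_const)
    convert hU.preimage continuous_subtype_val
    ext ⟨v, hv⟩
    simp only [Set.mem_singleton_iff, AddSubgroup.mk_eq_zero, Set.mem_preimage]
    constructor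
    · rintro rfl
      intro i
      simp
    · intro h
      obtain ⟨p, q, rfl⟩ := (mem_closure_range_union l m v).1 hv
      refine Finset.sum_eq_zero fun i _ => ?_
      have key (k : ℤ) (hk : |(k : ℝ) * d i| < 1) : k = 0 := by
        have h1 : |k * (d i : ℤ)| < 1 := by exact_mod_cast hk
        rcases mul_eq_zero.1 (Int.abs_lt_one_iff.1 h1) with h2 | h2
        · exact h2
        · exact absurd (by exact_mod_cast h2) (S.pos i).ne'
      have h1 := (h i).1
      have h2 := (h i).2
      rw [sum_zsmul_eq_sum_smul, S.im_sum_right] at h1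
      rw [sum_zsmul_eq_sum_smul, S.im_sum_left, abs_neg] at h2
      rw [key _ h1, key _ h2, zero_smul, zero_smul, add_zero]
  · rw [Submodule.eq_top_iff']
    intro v
    obtain ⟨x, y, rfl⟩ := S.span v
    refine Submodule.sum_mem _ fun i _ => Submodule.add_mem _ ?_ ?_
    · rw [Complex.coe_smul]
      exact Submodule.smul_mem _ _
        (Submodule.subset_span (AddSubgroup.subset_closure (Or.inl ⟨i, rfl⟩)))
    · rw [Complex.coe_smul]
      exact Submodule.smul_mem _ _
        (Submodule.subset_span (AddSubgroup.subset_closure (Or.inr ⟨i, rfl⟩)))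

lemma ker_kernelParam (S : IsSymplecticFrame H d l m) :
    (kernelParam d l m (AddSubgroup.closure (Set.range l ∪ Set.range m))).ker =
      (reductionHom d).ker := by
  ext ⟨p, q⟩
  have e : kernelParam d l m (AddSubgroup.closure (Set.range l ∪ Set.range m)) (p, q) =
      QuotientAddGroup.mk (∑ i, (((p i / d i : ℝ) : ℂ) • l i + ((q i / d i : ℝ) : ℂ) • m i)) := rfl
  rw [AddMonoidHom.mem_ker, e, QuotientAddGroup.eq_zero_iff, S.mem_lattice_iff,
    AddMonoidHom.mem_ker]
  have key (i : ι) (k : ℤ) : (∃ j : ℤ, (k / d i : ℝ) = j) ↔ (k : ZMod (d i)) = 0 := by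
    have hd : (d i : ℝ) ≠ 0 := by exact_mod_cast (S.pos i).ne'
    rw [ZMod.intCast_zmod_eq_zero_iff_dvd]
    constructor
    · rintro ⟨j, hj⟩
      rw [div_eq_iff hd] at hj
      exact ⟨j, by rw [mul_comm]; exact_mod_cast hj⟩
    · rintro ⟨j, hj⟩
      exact ⟨j, by rw [div_eq_iff hd, hj]; push_cast; ring⟩
  simp only [key]
  simp [reductionHom, Prod.ext_iff, funext_iff, forall_and]

lemma range_kernelParam (S : IsSymplecticFrame H d l m)
    (H' : neronSeveri (AddSubgroup.closure (Set.range l ∪ Set.range m))) (hH : H'.1 = H) :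
    (kernelParam d l m (AddSubgroup.closure (Set.range l ∪ Set.range m))).range =
      (polarisingHom H').ker := by
  have e (v : V) : polarisingHom H' (QuotientAddGroup.mk v) = QuotientAddGroup.mk (H v) := by
    rw [← hH]; rfl
  have hd (i : ι) : (d i : ℝ) ≠ 0 := by exact_mod_cast (S.pos i).ne'
  ext v
  induction v using QuotientAddGroup.induction_on with | H v => ?_
  obtain ⟨x, y, rfl⟩ := S.span v
  rw [AddMonoidHom.mem_ker, e, QuotientAddGroup.eq_zero_iff, S.mem_dualLattice_iff]
  constructor
  · rintro ⟨⟨p, q⟩, h⟩ i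
    have h' : (QuotientAddGroup.mk
        (∑ i, (((p i / d i : ℝ) : ℂ) • l i + ((q i / d i : ℝ) : ℂ) • m i)) :
        V ⧸ AddSubgroup.closure (Set.range l ∪ Set.range m)) = QuotientAddGroup.mk _ := h
    rw [eq_comm, ← sub_eq_zero, ← QuotientAddGroup.mk_sub, QuotientAddGroup.eq_zero_iff,
      ← Finset.sum_sub_distrib] at h'
    have h2 := (S.mem_lattice_iff (fun i => x i - p i / d i) (fun i => y i - q i / d i)).1 (by
      convert h' using 2 with i
      push_cast
      module)
    obtain ⟨⟨k, hk⟩, ⟨k', hk'⟩⟩ := h2 i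
    refine ⟨⟨k * d i + p i, ?_⟩, ⟨k' * d i + q i, ?_⟩⟩
    · push_cast
      rw [← hk]
      field_simp [hd i]
      ring
    · push_cast
      rw [← hk']
      field_simp [hd i]
      ring
  · intro h
    choose p hp using fun i => (h i).1
    choose q hq using fun i => (h i).2
    refine ⟨(p, q), ?_⟩
    change QuotientAddGroup.mk
      (∑ i, (((p i / d i : ℝ) : ℂ) • l i + ((q i / d i : ℝ) : ℂ) • m i)) = _
    congr 1
    refine Finset.sum_congr rfl fun i _ => ?_
    rw [← hp, ← hq, mul_div_cancel_right₀ _ (hd i), mul_div_cancel_right₀ _ (hd i)]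

/-- `kernelParam` maps onto the kernel of `φ_H` and has the same kernel as the surjection
`reductionHom`, so the two images are isomorphic. -/
theorem isPolarisationOfType {n : ℕ} {d : Fin n → ℕ} {l m : Fin n → V} {Λ : AddSubgroup V}
    {H : neronSeveri Λ} (S : IsSymplecticFrame H.1 d l m)
    (hΛ : Λ = AddSubgroup.closure (Set.range l ∪ Set.range m)) (hn : Module.finrank ℂ V = n)
    (hpos : ∀ v : V, v ≠ 0 → 0 < (H.1 v v).re) (hd : ∀ i j, i ≤ j → d i ∣ d j) :
    IsPolarisationOfType H d := by
  subst hΛ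
  refine ⟨hn, hpos, S.pos, hd, ⟨?_⟩⟩
  rw [← S.range_kernelParam H rfl]
  exact (QuotientAddGroup.quotientKerEquivRange _).symm.trans
    ((QuotientAddGroup.quotientAddEquivOfEq S.ker_kernelParam).trans
      (QuotientAddGroup.quotientKerEquivOfSurjective _ (reductionHom_surjective d)))

end IsSymplecticFrame

end Frames

end

noncomputable section

/-! ### Lifting homomorphisms of complex tori -/

section Lifting

variable {V W : Type*} [NormedAddCommGroup V] [NormedSpace ℂ V]
  [NormedAddCommGroup W] [NormedSpace ℂ W]

lemma exists_pos_forall_norm_lt {W : Type*} [NormedAddCommGroup W] {Λ : AddSubgroup W}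
    (h : DiscreteTopology Λ) :
    ∃ ε > 0, ∀ x ∈ Λ, ‖x‖ < ε → x = 0 := by
  obtain ⟨ε, hε, hb⟩ := Metric.isOpen_iff.1 (isOpen_discrete ({0} : Set Λ)) 0 rfl
  refine ⟨ε, hε, fun x hx hn => ?_⟩
  have : (⟨x, hx⟩ : Λ) ∈ ({0} : Set Λ) := hb (by simpa [Metric.mem_ball, dist_zero_right] using hn)
  simpa using this

/-- A holomorphic homomorphism of complex tori lifts to a `ℂ`-linear map. -/
theorem IsHolomorphicHom.exists_lift {Λ : AddSubgroup V} {Λ' : AddSubgroup W}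
    (hΛ' : DiscreteTopology Λ') {f : V ⧸ Λ →+ W ⧸ Λ'} (hf : IsHolomorphicHom f) :
    ∃ L : V →L[ℂ] W, ∀ v : V, f (QuotientAddGroup.mk v) = QuotientAddGroup.mk (L v) := by
  obtain ⟨U, hU, g, hg, hfg⟩ := hf 0
  obtain ⟨ε, hε, hΛε⟩ := exists_pos_forall_norm_lt hΛ'
  have hgd : DifferentiableAt ℂ g 0 := hg.differentiableAt hU
  have hg0 : g 0 ∈ Λ' := by
    rw [← QuotientAddGroup.eq_zero_iff, ← hfg 0 (mem_of_mem_nhds hU), QuotientAddGroup.mk_zero,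
      map_zero]
  have hcont := hgd.continuousAt.eventually (Metric.ball_mem_nhds (g 0) (by positivity : 0 < ε / 3))
  obtain ⟨δ, hδ, hball⟩ := Metric.eventually_nhds_iff_ball.1
    (hcont.and (Filter.eventually_mem_set.2 hU))
  set L := fderiv ℂ g 0
  -- The difference of the two sides is a lattice vector because `f` is additive, and it is shorter
  -- than `ε/3 + 2 · ε/3`, so it vanishes.
  have hdouble (x : V) (hx : ‖x‖ < δ) : g x - g 0 = (2 : ℂ) • (g ((2 : ℂ)⁻¹ • x) - g 0) := by
    have hx' : ‖(2 : ℂ)⁻¹ • x‖ < δ := by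
      rw [norm_smul]
      norm_num
      linarith [norm_nonneg x]
    obtain ⟨h1, h1U⟩ := hball x (by simpa using hx)
    obtain ⟨h2, h2U⟩ := hball _ (by simpa using hx' : (2 : ℂ)⁻¹ • x ∈ Metric.ball (0 : V) δ)
    rw [dist_eq_norm] at h1 h2
    rw [← sub_eq_zero]
    refine hΛε _ ?_ ?_
    · have e : g x - g 0 - (2 : ℂ) • (g ((2 : ℂ)⁻¹ • x) - g 0) =
          (g x - (g ((2 : ℂ)⁻¹ • x) + g ((2 : ℂ)⁻¹ • x))) + g 0 := by module
      rw [e]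
      refine Λ'.add_mem ?_ hg0
      rw [← QuotientAddGroup.eq_zero_iff, QuotientAddGroup.mk_sub, QuotientAddGroup.mk_add,
        ← hfg _ h1U, ← hfg _ h2U, ← map_add, ← map_sub, ← QuotientAddGroup.mk_add,
        ← QuotientAddGroup.mk_sub, ← add_smul]
      norm_num
    · calc _ ≤ ‖g x - g 0‖ + ‖(2 : ℂ) • (g ((2 : ℂ)⁻¹ • x) - g 0)‖ := norm_sub_le _ _
        _ = ‖g x - g 0‖ + 2 * ‖g ((2 : ℂ)⁻¹ • x) - g 0‖ := by rw [norm_smul]; norm_num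
        _ < ε := by linarith
  have hpow (x : V) (hx : ‖x‖ < δ) (n : ℕ) :
      g x - g 0 = ((2 : ℂ) ^ n) • (g (((2 : ℂ) ^ n)⁻¹ • x) - g 0) := by
    induction n with
    | zero => simp
    | succ n ih =>
      have hx' : ‖((2 : ℂ) ^ n)⁻¹ • x‖ < δ := by
        rw [norm_smul]
        refine lt_of_le_of_lt (mul_le_of_le_one_left (norm_nonneg x) ?_) hx
        rw [norm_inv, norm_pow]
        exact inv_le_one_of_one_le₀ (one_le_pow₀ (by norm_num))
      rw [ih, hdouble _ hx', smul_smul, smul_smul, pow_succ, mul_inv_rev]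
  have htop : Filter.Tendsto (fun n : ℕ => ‖(2 : ℂ) ^ n‖) Filter.atTop Filter.atTop := by
    simp only [norm_pow]
    exact tendsto_pow_atTop_atTop_of_one_lt (by norm_num)
  -- The constant sequence `2ⁿ(g(x/2ⁿ) - g 0)` converges to the derivative at `0`.
  have hlin (x : V) (hx : ‖x‖ < δ) : g x - g 0 = L x := by
    have lim := hgd.hasFDerivAt.lim x htop
    simp only [zero_add, ← hpow x hx] at lim
    exact tendsto_nhds_unique tendsto_const_nhds lim
  refine ⟨L, fun v => ?_⟩
  -- Additivity of `f` carries the identity from the small vector `v / 2ⁿ` to `v`.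
  obtain ⟨n, hn⟩ := (htop.eventually_gt_atTop (‖v‖ / δ)).exists
  have h2 : (2 : ℂ) ^ n ≠ 0 := pow_ne_zero _ two_ne_zero
  set u : V := ((2 : ℂ) ^ n)⁻¹ • v with hu
  have hun : ‖u‖ < δ := by
    rw [hu, norm_smul, norm_inv, inv_mul_lt_iff₀ (by positivity)]
    rwa [div_lt_iff₀ hδ] at hn
  have hv : v = (2 ^ n : ℕ) • u := by
    rw [← Nat.cast_smul_eq_nsmul ℂ, hu, smul_smul]
    push_cast
    rw [mul_inv_cancel₀ h2, one_smul]
  have huf : f (QuotientAddGroup.mk u) = QuotientAddGroup.mk (L u) := by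
    rw [hfg u (hball u (by simpa using hun)).2, ← hlin u hun, QuotientAddGroup.mk_sub,
      (QuotientAddGroup.eq_zero_iff _).2 hg0, sub_zero]
  rw [hv, map_nsmul, QuotientAddGroup.mk_nsmul, map_nsmul, huf, QuotientAddGroup.mk_nsmul]

end Lifting

/-! ### Elliptic curves with complex multiplication -/

lemma mem_planeLattice {ω η z : ℂ} : z ∈ planeLattice ω η ↔ ∃ p q : ℤ, z = p * ω + q * η := by
  simp only [planeLattice, AddSubgroup.mem_closure_pair, zsmul_eq_mul, eq_comm]

lemma discreteTopology_planeLattice {τ : ℂ} (hτ : 0 < τ.im) :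
    DiscreteTopology (planeLattice τ 1) := by
  apply discreteTopology_of_isOpen_singleton_zero
  have hU : IsOpen {z : ℂ | |z.im| < τ.im ∧ |z.re| < 1} :=
    (isOpen_lt Complex.continuous_im.abs continuous_const).inter
      (isOpen_lt Complex.continuous_re.abs continuous_const)
  convert hU.preimage continuous_subtype_val
  ext ⟨z, hz⟩
  simp only [Set.mem_singleton_iff, AddSubgroup.mk_eq_zero, Set.mem_preimage, Set.mem_ofPred_eq]
  constructor
  · rintro rfl
    simpa using hτ
  · rintro ⟨h1, h2⟩
    obtain ⟨p, q, rfl⟩ := mem_planeLattice.1 hz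
    have hp : p = 0 := by
      have h3 : |(p : ℝ)| < 1 :=
        lt_of_mul_lt_mul_right (by simpa [abs_mul, abs_of_pos hτ] using h1) hτ.le
      exact Int.abs_lt_one_iff.1 (by exact_mod_cast h3)
    subst hp
    have hq : q = 0 := by
      simp only [Int.cast_zero, zero_mul, zero_add, mul_one, Complex.intCast_re] at h2
      exact Int.abs_lt_one_iff.1 (by exact_mod_cast h2)
    simp [hq]

/-- The period of a curve with complex multiplication is imaginary quadratic. -/
lemma HasCM.exists_rat {τ : ℂ} (hτ : 0 < τ.im) (h : HasCM (planeLattice τ 1)) :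
    ∃ x s : ℚ, τ.re = x ∧ τ.im ^ 2 = s := by
  obtain ⟨f, hf, hne⟩ := h
  obtain ⟨L, hL⟩ := hf.exists_lift (discreteTopology_planeLattice hτ)
  have hLmul (z : ℂ) : L z = z * L 1 := by
    rw [← smul_eq_mul, ← map_smul, smul_eq_mul, mul_one]
  have hmem (z : ℂ) (hz : z ∈ planeLattice τ 1) : L z ∈ planeLattice τ 1 := by
    rw [← QuotientAddGroup.eq_zero_iff, ← hL, (QuotientAddGroup.eq_zero_iff z).2 hz, map_zero]
  obtain ⟨a, b, h1⟩ := mem_planeLattice.1 (hmem 1 (mem_planeLattice.2 ⟨0, 1, by simp⟩))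
  obtain ⟨c, e, h2⟩ := mem_planeLattice.1 (hmem τ (mem_planeLattice.2 ⟨1, 0, by simp⟩))
  -- With `a = 0` the endomorphism would be multiplication by the integer `b`.
  have ha : a ≠ 0 := by
    rintro rfl
    refine hne b (AddMonoidHom.ext fun v => ?_)
    induction v using QuotientAddGroup.induction_on with | H v => ?_
    rw [hL, hLmul, h1]
    change _ = b • QuotientAddGroup.mk v
    rw [← QuotientAddGroup.mk_zsmul]
    simp [mul_comm]
  rw [hLmul, h1] at h2
  have hre := congrArg Complex.re h2
  have him := congrArg Complex.im h2
  simp only [Complex.mul_re, Complex.mul_im, Complex.add_re, Complex.add_im, Complex.intCast_re,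
    Complex.intCast_im, Complex.one_re, Complex.one_im] at hre him
  have ha' : (a : ℝ) ≠ 0 := by exact_mod_cast ha
  have hx : τ.re = ((c - b) / (2 * a) : ℚ) := by
    push_cast
    rw [eq_div_iff (by positivity)]
    apply mul_right_cancel₀ hτ.ne'
    linear_combination him
  -- These come from `τ(aτ + b) = cτ + e`: the imaginary part gives `Re τ`, the real part is then
  -- solved for `(Im τ)²`.
  refine ⟨(c - b) / (2 * a), ((c - b) / (2 * a)) ^ 2 + b * ((c - b) / (2 * a)) / a
    - c * ((c - b) / (2 * a)) / a - e / a, hx, ?_⟩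
  push_cast at hx ⊢
  rw [← hx]
  field_simp
  linear_combination -hre

end

noncomputable section

open scoped Matrix

/-! ### Hermitian forms -/

section Forms

variable {V : Type*} [NormedAddCommGroup V] [NormedSpace ℂ V]

/-- The sesquilinear form `(v, w) ↦ p v * conj (q w)`. -/
def sesqProd (p q : V →L[ℂ] ℂ) : V →L[ℂ] V →L⋆[ℂ] ℂ :=
  p.smulRight ((starL ℂ : ℂ ≃L⋆[ℂ] ℂ).toContinuousLinearMap.comp q)

@[simp] lemma sesqProd_apply (p q : V →L[ℂ] ℂ) (v w : V) :
    sesqProd p q v w = p v * conj (q w) := by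
  simp [sesqProd]

/-- The Hermitian form `∑ vⱼ w̄ⱼ / Im tⱼ`. -/
def formB {ι : Type*} [Fintype ι] (t : ι → ℂ) : (ι → ℂ) →L[ℂ] (ι → ℂ) →L⋆[ℂ] ℂ :=
  ∑ j, ((t j).im : ℂ)⁻¹ • sesqProd (ContinuousLinearMap.proj j) (ContinuousLinearMap.proj j)

lemma formB_apply {ι : Type*} [Fintype ι] (t : ι → ℂ) (v w : ι → ℂ) :
    formB t v w = ∑ j, v j * conj (w j) / ((t j).im : ℂ) := by
  simp only [formB, sum_apply, smul_apply, sesqProd_apply, ContinuousLinearMap.proj_apply,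
    smul_eq_mul]
  exact Finset.sum_congr rfl fun j _ => by ring

/-- The Hermitian form `z z̄' / c + ∑ vⱼ v̄'ⱼ / Im tⱼ`. -/
def formA {ι : Type*} [Fintype ι] (c : ℝ) (t : ι → ℂ) :
    (ℂ × (ι → ℂ)) →L[ℂ] (ℂ × (ι → ℂ)) →L⋆[ℂ] ℂ :=
  (c : ℂ)⁻¹ • sesqProd (ContinuousLinearMap.fst ℂ ℂ (ι → ℂ)) (ContinuousLinearMap.fst ℂ ℂ (ι → ℂ)) +
  ∑ j, ((t j).im : ℂ)⁻¹ •
    sesqProd ((ContinuousLinearMap.proj j).comp (ContinuousLinearMap.snd ℂ ℂ (ι → ℂ)))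
      ((ContinuousLinearMap.proj j).comp (ContinuousLinearMap.snd ℂ ℂ (ι → ℂ)))

lemma formA_apply {ι : Type*} [Fintype ι] (c : ℝ) (t : ι → ℂ) (p q : ℂ × (ι → ℂ)) :
    formA c t p q = p.1 * conj q.1 / c + formB t p.2 q.2 := by
  rw [formB_apply]
  simp only [formA, add_apply, sum_apply, smul_apply, sesqProd_apply,
    ContinuousLinearMap.comp_apply, ContinuousLinearMap.proj_apply, smul_eq_mul]
  congr 1
  · simp; ring
  · exact Finset.sum_congr rfl fun j _ => by simp; ring

variable {ι : Type*} [Fintype ι]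

lemma formB_hermitian (t : ι → ℂ) (v w : ι → ℂ) : formB t w v = conj (formB t v w) := by
  simp [formB_apply, mul_comm]

lemma formA_hermitian (c : ℝ) (t : ι → ℂ) (v w : ℂ × (ι → ℂ)) :
    formA c t w v = conj (formA c t v w) := by
  rw [formA_apply, formA_apply, formB_hermitian]
  simp [mul_comm]

lemma formB_single_left [DecidableEq ι] (t : ι → ℂ) (i : ι) (a : ℂ) (w : ι → ℂ) :
    formB t (Pi.single i a) w = a * conj (w i) / ((t i).im : ℂ) := by
  rw [formB_apply, Finset.sum_eq_single i]
  · simp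
  · intro j _ hj
    simp [Pi.single_eq_of_ne hj]
  · simp

lemma formB_self_re (t v : ι → ℂ) :
    (formB t v v).re = ∑ j, Complex.normSq (v j) / (t j).im := by
  rw [formB_apply, Complex.re_sum]
  refine Finset.sum_congr rfl fun j _ => ?_
  rw [Complex.mul_conj, ← Complex.ofReal_div, Complex.ofReal_re]

lemma formB_nonneg {t : ι → ℂ} (ht : ∀ j, 0 < (t j).im) (v : ι → ℂ) : 0 ≤ (formB t v v).re := by
  rw [formB_self_re]
  exact Finset.sum_nonneg fun j _ => div_nonneg (Complex.normSq_nonneg _) (ht j).le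

lemma formB_pos {t : ι → ℂ} (ht : ∀ j, 0 < (t j).im) {v : ι → ℂ} (hv : v ≠ 0) :
    0 < (formB t v v).re := by
  rw [formB_self_re]
  obtain ⟨i, hi⟩ := Function.ne_iff.1 hv
  exact Finset.sum_pos' (fun j _ => div_nonneg (Complex.normSq_nonneg _) (ht j).le)
    ⟨i, Finset.mem_univ i, div_pos (Complex.normSq_pos.2 hi) (ht i)⟩

lemma formA_pos {c : ℝ} (hc : 0 < c) {t : ι → ℂ} (ht : ∀ j, 0 < (t j).im) {v : ℂ × (ι → ℂ)}
    (hv : v ≠ 0) : 0 < (formA c t v v).re := by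
  rw [formA_apply, Complex.mul_conj, ← Complex.ofReal_div, Complex.add_re, Complex.ofReal_re]
  by_cases h : v.2 = 0
  · have h1 : v.1 ≠ 0 := fun h1 => hv (Prod.ext h1 h)
    exact add_pos_of_pos_of_nonneg (div_pos (Complex.normSq_pos.2 h1) hc) (formB_nonneg ht _)
  · exact add_pos_of_nonneg_of_pos (div_nonneg (Complex.normSq_nonneg _) hc.le) (formB_pos ht h)

/-- The Gram matrix of a positive definite Hermitian form in a basis in which it is real. -/
lemma posDef_gram {H : V →L[ℂ] V →L⋆[ℂ] ℂ} (hH : ∀ v w, H w v = conj (H v w))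
    (hpos : ∀ v : V, v ≠ 0 → 0 < (H v v).re) (b : Module.Basis ι ℂ V) :
    (Matrix.of fun i j => (H (b i) (b j)).re).PosDef := by
  refine Matrix.PosDef.of_dotProduct_mulVec_pos ?_ fun x hx => ?_
  · refine Matrix.IsHermitian.ext fun i j => ?_
    change (H (b j) (b i)).re = (H (b i) (b j)).re
    rw [hH (b i) (b j), Complex.conj_re]
  · have hne : ∑ i, (x i : ℂ) • b i ≠ 0 := by
      intro h0
      apply hx
      ext i
      have := Fintype.linearIndependent_iff.1 b.linearIndependent (fun i => (x i : ℂ)) h0 i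
      exact_mod_cast this
    have hsum : (H (∑ i, (x i : ℂ) • b i) (∑ i, (x i : ℂ) • b i)).re =
        star x ⬝ᵥ ((Matrix.of fun i j => (H (b i) (b j)).re) *ᵥ x) := by
      simp only [map_sum, map_smul, sum_apply, smul_apply, map_smulₛₗ, Complex.conj_ofReal,
        Complex.re_sum, smul_eq_mul, Complex.re_ofReal_mul, dotProduct, Matrix.mulVec, star_trivial,
        Matrix.of_apply, Finset.mul_sum]
      rw [Finset.sum_comm]
      exact Finset.sum_congr rfl fun i _ => Finset.sum_congr rfl fun j _ => by ring
    rw [← hsum]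
    exact hpos _ hne

end Forms

/-! ### The lattices of `E`, `B` and `A` -/

section Lattices

variable {m : ℕ} {d : Fin (m + 1) → ℕ} {t : Fin (m + 1) → ℂ}

lemma mem_latticeB {x : Fin (m + 1) → ℂ} :
    x ∈ latticeB d t ↔ ∀ j, ∃ p q : ℤ, x j = p * t j + q * d j := by
  simp only [latticeB, AddSubgroup.mem_pi, Set.mem_univ, forall_true_left, mem_planeLattice]

/-- One integer `k` accounts for both the multiple of `(P, Q)` and the real period `dₙ` of `E`:
changing `k` by a multiple of `dₙ` moves the last coordinate by a period of `B`. -/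
lemma mem_latticeA {x : ℂ × (Fin (m + 1) → ℂ)} :
    x ∈ latticeA d t ↔ ∃ p k : ℤ, x.1 = p * (d (Fin.last m) * (Real.pi * Complex.I)) + k ∧
      ∀ j, ∃ q r : ℤ,
        x.2 j = q * t j + r * d j - k * Pi.single (M := fun _ => ℂ) (Fin.last m) 1 j := by
  have h : x ∈ latticeA d t ↔ ∃ k : ℤ, x - k • (1, -Pi.single (Fin.last m) 1) ∈
      (latticeE (d (Fin.last m))).prod (latticeB d t) := by
    rw [latticeA, quotientLattice, AddSubgroup.mem_comap, AddSubgroup.mem_zmultiples_iff]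
    refine exists_congr fun k => ?_
    rw [← QuotientAddGroup.eq_zero_iff, QuotientAddGroup.mk_sub, sub_eq_zero, eq_comm]
    rfl
  rw [h]
  simp only [AddSubgroup.mem_prod, latticeE, mem_planeLattice, mem_latticeB]
  constructor
  · rintro ⟨k, ⟨p, q, h1⟩, h2⟩
    refine ⟨p, k + q * d (Fin.last m), ?_, fun j => ?_⟩
    · simp only [Prod.fst_sub, Prod.smul_fst] at h1
      rw [zsmul_eq_mul, mul_one] at h1
      push_cast
      linear_combination h1
    · obtain ⟨r, s, h3⟩ := h2 j
      simp only [Prod.snd_sub, Prod.smul_snd, Pi.sub_apply, Pi.smul_apply, Pi.neg_apply] at h3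
      rw [zsmul_eq_mul] at h3
      by_cases hj : j = Fin.last m
      · subst hj
        refine ⟨r, s + q, ?_⟩
        push_cast
        rw [Pi.single_eq_same] at *
        linear_combination h3
      · refine ⟨r, s, ?_⟩
        rw [Pi.single_eq_of_ne hj] at *
        linear_combination h3
  · rintro ⟨p, k, h1, h2⟩
    refine ⟨k, ⟨p, 0, ?_⟩, fun j => ?_⟩
    · simp [h1]
    · obtain ⟨q, r, h3⟩ := h2 j
      exact ⟨q, r, by simp [h3]⟩

/-- The first half of the symplectic frame of the lattice of `A`. -/
def frameLeft (a : ℂ) (t : Fin (m + 1) → ℂ) : Fin (m + 2) → ℂ × (Fin (m + 1) → ℂ) :=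
  Fin.cons (a, 0) fun j => (Pi.single (M := fun _ => ℂ) (Fin.last m) a j, Pi.single j (t j))

/-- The second half of the symplectic frame of the lattice of `A`. -/
def frameRight (d : Fin (m + 1) → ℕ) : Fin (m + 2) → ℂ × (Fin (m + 1) → ℂ) :=
  Fin.cons (1, -Pi.single (Fin.last m) 1) fun j => (0, Pi.single j (d j : ℂ))

lemma latticeB_eq_closure : latticeB d t = AddSubgroup.closure
    (Set.range (fun j => Pi.single (M := fun _ => ℂ) j (t j)) ∪
      Set.range (fun j => Pi.single (M := fun _ => ℂ) j (d j : ℂ))) := by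
  have key (p q : Fin (m + 1) → ℤ) (j : Fin (m + 1)) :
      (∑ i, (p i • Pi.single (M := fun _ => ℂ) i (t i) +
        q i • Pi.single (M := fun _ => ℂ) i (d i : ℂ))) j = p j * t j + q j * d j := by
    rw [Finset.sum_apply, Finset.sum_eq_single j]
    · simp
    · intro i _ hi
      simp [Pi.single_eq_of_ne hi.symm]
    · simp
  ext x
  rw [mem_latticeB, mem_closure_range_union]
  constructor
  · intro h
    choose p q h using h
    exact ⟨p, q, funext fun j => by rw [key, h]⟩
  · rintro ⟨p, q, rfl⟩ j
    exact ⟨p j, q j, key p q j⟩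

/-- A general ring of coefficients covers both integral coordinates, for lattice membership, and
real ones, for spanning. -/
lemma sum_frame (R : Type*) [Ring R] [Module R ℂ] (a : ℂ) (p q : Fin (m + 2) → R) :
    ∑ i, (p i • frameLeft a t i + q i • frameRight d i) =
      (p 0 • a + p (Fin.last (m + 1)) • a + q 0 • (1 : ℂ), fun j =>
        p j.succ • t j + q j.succ • (d j : ℂ) -
          q 0 • Pi.single (M := fun _ => ℂ) (Fin.last m) 1 j) := by
  rw [Fin.sum_univ_succ]
  ext j
  · simp only [frameLeft, frameRight, Fin.cons_zero, Fin.cons_succ, Prod.fst_add, Prod.fst_sum,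
      Prod.smul_fst, smul_zero, add_zero]
    rw [Finset.sum_eq_single (Fin.last m)]
    · rw [Pi.single_eq_same, Fin.succ_last]
      abel
    · intro i _ hi
      simp [Pi.single_eq_of_ne hi]
    · simp
  · simp only [frameLeft, frameRight, Fin.cons_zero, Fin.cons_succ, Prod.snd_add, Prod.snd_sum,
      Prod.smul_snd, smul_zero, zero_add, Pi.add_apply, Finset.sum_apply, Pi.smul_apply,
      Pi.neg_apply, smul_neg]
    rw [Finset.sum_eq_single j]
    · rw [Pi.single_eq_same, Pi.single_eq_same]
      abel
    · intro i _ hi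
      simp [Pi.single_eq_of_ne hi.symm]
    · simp

lemma latticeA_eq_closure : latticeA d t = AddSubgroup.closure
    (Set.range (frameLeft (d (Fin.last m) * (Real.pi * Complex.I)) t) ∪
      Set.range (frameRight d)) := by
  ext x
  rw [mem_latticeA, mem_closure_range_union]
  simp only [sum_frame]
  constructor
  · rintro ⟨p, k, h1, h2⟩
    choose q r h2 using h2
    -- The last left frame vector also contributes `a` to the first coordinate; this is subtracted
    -- here.
    refine ⟨Fin.cons (p - q (Fin.last m)) q, Fin.cons k r, Prod.ext ?_ (funext fun j => ?_)⟩
    · rw [h1, ← Fin.succ_last]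
      simp only [Fin.cons_zero, Fin.cons_succ, zsmul_eq_mul]
      push_cast
      ring
    · rw [h2]
      simp
  · rintro ⟨p, q, rfl⟩
    refine ⟨p 0 + p (Fin.last (m + 1)), q 0, ?_, fun j => ⟨p j.succ, q j.succ, ?_⟩⟩
    · simp only [zsmul_eq_mul]
      push_cast
      ring
    · simp

lemma exists_real_coordinates {τ : ℂ} (hτ : 0 < τ.im) {n : ℕ} (hn : 0 < n) (z : ℂ) :
    ∃ x y : ℝ, z = x * τ + y * n := by
  have hn' : (n : ℝ) ≠ 0 := by exact_mod_cast hn.ne'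
  refine ⟨z.im / τ.im, (z.re - z.im / τ.im * τ.re) / n, Complex.ext ?_ ?_⟩
  · simp
    field_simp
    ring
  · simp
    field_simp

lemma isSymplecticFrame_formB (hd : ∀ j, 0 < d j) (ht : ∀ j, 0 < (t j).im) :
    IsSymplecticFrame (formB t) d (fun j => Pi.single (M := fun _ => ℂ) j (t j))
      (fun j => Pi.single (M := fun _ => ℂ) j (d j : ℂ)) where
  pos := hd
  hermitian := formB_hermitian t
  left i j := by
    rw [formB_single_left]
    by_cases h : i = j
    · subst h
      rw [Pi.single_eq_same, Complex.mul_conj, ← Complex.ofReal_div, Complex.ofReal_im]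
    · simp [h]
  right i j := by
    rw [formB_single_left]
    by_cases h : i = j
    · subst h
      rw [Pi.single_eq_same, Complex.mul_conj, ← Complex.ofReal_div, Complex.ofReal_im]
    · simp [h]
  pairing i j := by
    rw [formB_single_left]
    by_cases h : i = j
    · subst h
      have := (ht i).ne'
      rw [Pi.single_eq_same, if_pos rfl, Complex.conj_natCast, Complex.div_ofReal_im]
      simp
      field_simp
    · simp [h]
  span v := by
    choose x y h using fun j => exists_real_coordinates (ht j) (hd j) (v j)
    refine ⟨x, y, funext fun j => ?_⟩
    rw [Finset.sum_apply, Finset.sum_eq_single j]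
    · simp [← h]
    · intro i _ hi
      simp [Pi.single_eq_of_ne hi.symm]
    · simp

lemma exists_fst_frameLeft (a : ℂ) (t : Fin (m + 1) → ℂ) (i : Fin (m + 2)) :
    ∃ s : ℝ, (frameLeft a t i).1 = s * a := by
  induction i using Fin.cases with
  | zero => exact ⟨1, by simp [frameLeft]⟩
  | succ i =>
    refine ⟨Pi.single (M := fun _ => ℝ) (Fin.last m) 1 i, ?_⟩
    by_cases h : i = Fin.last m
    · subst h
      simp [frameLeft]
    · simp [frameLeft, h]

lemma exists_fst_frameRight (d : Fin (m + 1) → ℕ) (i : Fin (m + 2)) :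
    ∃ r : ℝ, (frameRight d i).1 = r := by
  induction i using Fin.cases with
  | zero => exact ⟨1, by simp [frameRight]⟩
  | succ i => exact ⟨0, by simp [frameRight]⟩

lemma isSymplecticFrame_formA (hd : ∀ j, 0 < d j) (ht : ∀ j, 0 < (t j).im) {N : ℕ} (hN : 0 < N) :
    IsSymplecticFrame (formA (N * Real.pi) t) (Fin.cons 1 d : Fin (m + 2) → ℕ)
      (frameLeft (N * (Real.pi * Complex.I)) t) (frameRight d) where
  pos := Fin.cases one_pos hd
  hermitian := formA_hermitian _ t
  left i j := by
    have hB := (isSymplecticFrame_formB hd ht).left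
    obtain ⟨s, hs⟩ := exists_fst_frameLeft (N * (Real.pi * Complex.I)) t i
    obtain ⟨s', hs'⟩ := exists_fst_frameLeft (N * (Real.pi * Complex.I)) t j
    have h1 : ((frameLeft (N * (Real.pi * Complex.I)) t i).1 *
        conj (frameLeft (N * (Real.pi * Complex.I)) t j).1 / ((N * Real.pi : ℝ) : ℂ)).im = 0 := by
      rw [hs, hs', Complex.div_ofReal_im]
      simp
    rw [formA_apply, Complex.add_im, h1, zero_add]
    induction i using Fin.cases <;> induction j using Fin.cases <;> simp [frameLeft, hB]
  right i j := by
    have hB := (isSymplecticFrame_formB hd ht).right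
    obtain ⟨s, hs⟩ := exists_fst_frameRight d i
    obtain ⟨s', hs'⟩ := exists_fst_frameRight d j
    have h1 : ((frameRight d i).1 * conj (frameRight d j).1 / ((N * Real.pi : ℝ) : ℂ)).im = 0 := by
      rw [hs, hs', Complex.div_ofReal_im]
      simp
    rw [formA_apply, Complex.add_im, h1, zero_add]
    have h2 (v w : Fin (m + 1) → ℂ) (hv : ∀ i, (v i).im = 0) (hw : ∀ i, (w i).im = 0) :
        (formB t v w).im = 0 := by
      rw [formB_apply, Complex.im_sum]
      refine Finset.sum_eq_zero fun j _ => ?_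
      rw [Complex.div_ofReal_im]
      simp [hv, hw]
    have h3 (i : Fin (m + 2)) (j : Fin (m + 1)) : ((frameRight d i).2 j).im = 0 := by
      induction i using Fin.cases with
      | zero => by_cases h : j = Fin.last m <;> simp [frameRight, h]
      | succ i =>
        by_cases h : j = i
        · subst h
          simp [frameRight]
        · simp [frameRight, h]
    exact h2 _ _ (h3 i) (h3 j)
  pairing i j := by
    have hB := (isSymplecticFrame_formB hd ht).pairing
    have hN' : (N : ℂ) ≠ 0 := by exact_mod_cast hN.ne'
    have hpi : (Real.pi : ℂ) ≠ 0 := by exact_mod_cast Real.pi_ne_zero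
    have hI : (N : ℂ) * (Real.pi * Complex.I) / ((N * Real.pi : ℝ) : ℂ) = Complex.I := by
      push_cast
      field_simp
    rw [formA_apply, Complex.add_im]
    induction i using Fin.cases with
    | zero =>
      induction j using Fin.cases with
      | zero =>
        simp only [frameLeft, frameRight, Fin.cons_zero, map_one, mul_one, hI]
        simp
      | succ j => simp [frameLeft, frameRight, (Fin.succ_ne_zero j).symm]
    | succ i =>
      induction j using Fin.cases with
      | zero =>
        have := (ht i).ne'
        simp only [frameLeft, frameRight, Fin.cons_zero, Fin.cons_succ, map_one, mul_one, map_neg,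
          formB_single_left, if_neg (Fin.succ_ne_zero i)]
        -- The entry `a` in the last left frame vector is there for this case: its pairing `1` with
        -- the `E`-component cancels the `-1` from `-eₙ`.
        by_cases h : i = Fin.last m
        · subst h
          rw [Pi.single_eq_same, hI, Pi.single_eq_same, map_one, mul_one, Complex.neg_im,
            Complex.div_ofReal_im, div_self this, Complex.I_im, add_neg_cancel]
        · simp [h]
      | succ j => simp [frameLeft, frameRight, hB, Fin.succ_inj]
  span v := by
    have hN' : (N : ℝ) * Real.pi ≠ 0 := mul_ne_zero (by exact_mod_cast hN.ne') Real.pi_ne_zero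
    choose x y h using fun j => exists_real_coordinates (ht j) (hd j)
      (v.2 j + v.1.re * Pi.single (M := fun _ => ℂ) (Fin.last m) 1 j)
    refine ⟨Fin.cons (v.1.im / (N * Real.pi) - x (Fin.last m)) x, Fin.cons v.1.re y, ?_⟩
    simp only [Complex.coe_smul]
    rw [sum_frame]
    refine Prod.ext ?_ (funext fun j => ?_)
    · rw [← Fin.succ_last]
      simp only [Fin.cons_zero, Fin.cons_succ]
      rw [← add_smul, sub_add_cancel]
      have h1 : ((v.1.im / (N * Real.pi) : ℝ) : ℂ) * (N * (Real.pi * Complex.I)) =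
          v.1.im * Complex.I := by
        have hN₁ : (N : ℂ) ≠ 0 := by exact_mod_cast hN.ne'
        have hpi : (Real.pi : ℂ) ≠ 0 := by exact_mod_cast Real.pi_ne_zero
        push_cast
        field_simp
      rw [Complex.real_smul, Complex.real_smul, h1, mul_one]
      exact (Complex.re_add_im v.1).symm.trans (add_comm _ _)
    · simp only [Fin.cons_zero, Fin.cons_succ, Complex.real_smul]
      rw [← h]
      ring

/-- The basis of `ℂⁿ` in which `A` has its big period matrix. -/
def periodBasis (m : ℕ) : Module.Basis (Fin (m + 2)) ℂ (ℂ × (Fin (m + 1) → ℂ)) :=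
  Module.Basis.ofEquivFun
    { toFun := fun v => Fin.cons v.1 (v.2 + v.1 • Pi.single (Fin.last m) 1)
      map_add' := fun v w => by
        ext i
        induction i using Fin.cases with
        | zero => simp
        | succ i => simp; ring
      map_smul' := fun c v => by
        ext i
        induction i using Fin.cases with
        | zero => simp
        | succ i => simp; ring
      invFun := fun x => (x 0, fun j =>
        x j.succ - x 0 * Pi.single (M := fun _ => ℂ) (Fin.last m) 1 j)
      left_inv := fun v => by
        ext j
        · simp
        · simp
      right_inv := fun x => by
        ext i
        induction i using Fin.cases with
        | zero => simp
        | succ i => simp }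

lemma sum_smul_periodBasis (x : Fin (m + 2) → ℂ) : ∑ i, x i • periodBasis m i =
    (x 0, fun j => x j.succ - x 0 * Pi.single (M := fun _ => ℂ) (Fin.last m) 1 j) := by
  rw [← Module.Basis.equivFun_symm_apply, periodBasis, Module.Basis.equivFun_ofEquivFun]
  rfl

lemma periodBasis_apply (i : Fin (m + 2)) : periodBasis m i =
    Fin.cons (α := fun _ => ℂ × (Fin (m + 1) → ℂ)) (1, -Pi.single (Fin.last m) 1)
      (fun j => (0, Pi.single j 1)) i := by
  have h := sum_smul_periodBasis (m := m) (Pi.single i 1)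
  rw [Finset.sum_eq_single i (fun j _ hj => by simp [hj]) (by simp), Pi.single_eq_same,
    one_smul] at h
  rw [h]
  induction i using Fin.cases with
  | zero => simp; rfl
  | succ i =>
    simp only [Fin.cons_succ]
    refine Prod.ext (by simp) (funext fun j => ?_)
    by_cases hj : j = i
    · subst hj
      simp
    · simp [hj]

lemma smallPeriodMatrix_zero (a : ℂ) (t : Fin (m + 1) → ℂ) (j : Fin (m + 2)) :
    smallPeriodMatrix a t 0 j = (frameLeft a t j).1 := by
  simp only [smallPeriodMatrix, frameLeft, Matrix.add_apply, Matrix.diagonal_apply,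
    Matrix.single_apply, ← Fin.succ_last]
  induction j using Fin.cases with
  | zero => simp
  | succ j => simp [-Fin.succ_last, (Fin.succ_ne_zero _).symm, Pi.single_apply,
      eq_comm (a := Fin.last m)]

lemma smallPeriodMatrix_succ (a : ℂ) (t : Fin (m + 1) → ℂ) (i : Fin (m + 1)) (j : Fin (m + 2)) :
    smallPeriodMatrix a t i.succ j = (frameLeft a t j).2 i +
      (frameLeft a t j).1 * Pi.single (M := fun _ => ℂ) (Fin.last m) 1 i  := by
  simp only [smallPeriodMatrix, frameLeft, Matrix.add_apply, Matrix.diagonal_apply,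
    Matrix.single_apply, ← Fin.succ_last]
  induction j using Fin.cases with
  | zero => simp [-Fin.succ_last, Pi.single_apply, (Fin.succ_ne_zero _).symm,
      eq_comm (a := Fin.last m)]
  | succ j =>
    by_cases h1 : i = j
    · subst h1
      by_cases h2 : i = Fin.last m
      · simp [-Fin.succ_last, Pi.single_apply, h2, (Fin.succ_ne_zero _).symm]
      · simp [-Fin.succ_last, h2, Ne.symm h2, (Fin.succ_ne_zero _).symm]
    · by_cases h2 : i = Fin.last m
      · subst h2
        simp [-Fin.succ_last, h1, Ne.symm h1, (Fin.succ_ne_zero _).symm]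
      · simp [-Fin.succ_last, h1, h2, Ne.symm h2, (Fin.succ_ne_zero _).symm]

/-- The columns of the small period matrix of `A` in the basis `periodBasis`. -/
lemma sum_smallPeriodMatrix (a : ℂ) (t : Fin (m + 1) → ℂ) (j : Fin (m + 2)) :
    ∑ i, smallPeriodMatrix a t i j • periodBasis m i = frameLeft a t j := by
  rw [sum_smul_periodBasis, smallPeriodMatrix_zero]
  refine Prod.ext rfl (funext fun i => ?_)
  simp only [smallPeriodMatrix_succ, add_sub_cancel_right]

/-- This makes the right half of the frame the columns of `D`; the left half gives those of `Z` by
`sum_smallPeriodMatrix`. -/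
lemma smul_periodBasis (d : Fin (m + 1) → ℕ) (j : Fin (m + 2)) :
    (((Fin.cons 1 d : Fin (m + 2) → ℕ) j : ℕ) : ℂ) • periodBasis m j = frameRight d j := by
  rw [periodBasis_apply]
  induction j using Fin.cases with
  | zero => simp [frameRight]
  | succ j => simp [frameRight, ← Pi.single_smul]

lemma isSymm_smallPeriodMatrix (a : ℂ) (t : Fin (m + 1) → ℂ) :
    (smallPeriodMatrix a t).IsSymm := by
  simp only [Matrix.IsSymm, smallPeriodMatrix, Matrix.transpose_add, Matrix.diagonal_transpose,
    Matrix.transpose_single]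
  abel

theorem isBigPeriodMatrix_formA (hd : ∀ j, 0 < d j) (ht : ∀ j, 0 < (t j).im)
    {H : neronSeveri (latticeA d t)} (hH : H.1 = formA (d (Fin.last m) * Real.pi) t) :
    IsBigPeriodMatrix H (smallPeriodMatrix ((d (Fin.last m) : ℂ) * (Real.pi * Complex.I)) t)
      (Fin.cons 1 d : Fin (m + 2) → ℕ) := by
  set a : ℂ := (d (Fin.last m) : ℂ) * (Real.pi * Complex.I) with ha
  set c : ℝ := d (Fin.last m) * Real.pi with hc
  have hc0 : 0 < c := mul_pos (by exact_mod_cast hd _) Real.pi_pos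
  have S := isSymplecticFrame_formA hd ht (hd (Fin.last m))
  set b := periodBasis m
  have hd' (j : Fin (m + 2)) : (((Fin.cons 1 d : Fin (m + 2) → ℕ) j : ℕ) : ℝ) ≠ 0 := by
    exact_mod_cast (S.pos j).ne'
  have hreal (i j : Fin (m + 2)) : (formA c t (b i) (b j)).im = 0 := by
    have h := S.right i j
    rw [← smul_periodBasis, ← smul_periodBasis] at h
    simpa [hd'] using h
  set M : Matrix (Fin (m + 2)) (Fin (m + 2)) ℝ := Matrix.of fun i j => (formA c t (b i) (b j)).re
  have hM : M.PosDef := posDef_gram (formA_hermitian c t) (fun v hv => formA_pos hc0 ht hv) b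
  -- As `H` is real on the basis, the pairing of the `j`-th left with the `k`-th right frame vector
  -- is `d k` times the `(j, k)` entry of this product.
  have hmul : (smallPeriodMatrix a t).map Complex.im * M = 1 := by
    ext j k
    have h := S.pairing j k
    rw [← smul_periodBasis, ← sum_smallPeriodMatrix] at h
    simp only [map_sum, map_smul, sum_apply, smul_apply, map_smulₛₗ, Complex.conj_natCast,
      smul_eq_mul] at h
    rw [← Complex.ofReal_natCast, Complex.im_ofReal_mul, Complex.im_sum] at h
    rw [Matrix.mul_apply, Matrix.one_apply]
    apply mul_left_cancel₀ (hd' k)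
    refine Eq.trans (congrArg _ (Finset.sum_congr rfl fun i _ => ?_)) (h.trans ?_)
    · rw [Complex.mul_im, hreal i k, mul_zero, zero_add, Matrix.map_apply,
        (isSymm_smallPeriodMatrix a t).apply]
      rfl
    · by_cases hjk : j = k
      · simp [hjk]
      · simp [hjk]
  have hinv : ((smallPeriodMatrix a t).map Complex.im)⁻¹ = M := Matrix.inv_eq_right_inv hmul
  refine ⟨isSymm_smallPeriodMatrix a t, ?_, b, ?_, fun i j => ?_⟩
  · rw [← Matrix.posDef_inv_iff, hinv]
    exact hM
  · simp only [sum_smallPeriodMatrix, smul_periodBasis, b]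
    exact latticeA_eq_closure
  · rw [hinv, hH]
    exact Complex.ext rfl (by simpa using hreal i j)

end Lattices

end

noncomputable section

/-! ### Rationality -/

/-- The rational numbers, as a subfield of `ℝ`. -/
def ratField : Subfield ℝ := (Rat.castHom ℝ).fieldRange

lemma mem_ratField {x : ℝ} : x ∈ ratField ↔ ∃ q : ℚ, (q : ℝ) = x := Iff.rfl

/-- The complex numbers `p + q y i` with `p` and `q` rational. -/
def ratSpan (y : ℝ) : AddSubgroup ℂ where
  carrier := {z | z.re ∈ ratField ∧ z.im / y ∈ ratField}
  zero_mem' := by simp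
  add_mem' := fun ha hb => ⟨add_mem ha.1 hb.1, by
    rw [Complex.add_im, add_div]; exact add_mem ha.2 hb.2⟩
  neg_mem' := fun ha => ⟨neg_mem ha.1, by
    rw [Complex.neg_im, neg_div]; exact neg_mem ha.2⟩

lemma mem_ratSpan {y : ℝ} {z : ℂ} : z ∈ ratSpan y ↔ z.re ∈ ratField ∧ z.im / y ∈ ratField :=
  Iff.rfl

lemma natCast_mem_ratSpan (y : ℝ) (n : ℕ) : (n : ℂ) ∈ ratSpan y := by
  simp [mem_ratSpan]

lemma intCast_mem_ratSpan (y : ℝ) (n : ℤ) : (n : ℂ) ∈ ratSpan y := by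
  simp [mem_ratSpan]

lemma intCast_mul_mem_ratSpan {y : ℝ} (n : ℤ) {z : ℂ} (hz : z ∈ ratSpan y) :
    (n : ℂ) * z ∈ ratSpan y := by
  rw [← zsmul_eq_mul]
  exact zsmul_mem hz n

lemma eq_zero_of_mul_pi_sq_mem {r : ℝ} (hr : r ∈ ratField) (h : r * Real.pi ^ 2 ∈ ratField) :
    r = 0 := by
  by_contra h0
  refine irrational_pi_sq (mem_ratField.1 (?_ : Real.pi ^ 2 ∈ ratField))
  rw [← mul_div_cancel_left₀ (Real.pi ^ 2) h0]
  exact div_mem h hr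

/-- Squaring replaces `y` by the rational `y²`, which is why irrationality of `π²` is needed. -/
lemma eq_zero_of_mul_pi_mem {y p : ℝ} (hy : y ^ 2 ∈ ratField) (hy0 : y ≠ 0)
    (hp : p / y ∈ ratField) (h : p * Real.pi ∈ ratField) : p = 0 := by
  have h1 : (p / y) ^ 2 * y ^ 2 * Real.pi ^ 2 = (p * Real.pi) ^ 2 := by field_simp
  have h2 := eq_zero_of_mul_pi_sq_mem (mul_mem (pow_mem hp 2) hy) (h1 ▸ pow_mem h 2)
  simpa [hy0] using h2

lemma eq_zero_of_mul_pi_div_mem {y p : ℝ} (hy : y ^ 2 ∈ ratField) (hy0 : y ≠ 0)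
    (hp : p ∈ ratField) (h : p * Real.pi / y ∈ ratField) : p = 0 := by
  have h1 : p ^ 2 * Real.pi ^ 2 = (p * Real.pi / y) ^ 2 * y ^ 2 := by field_simp
  simpa using eq_zero_of_mul_pi_sq_mem (pow_mem hp 2) (h1 ▸ mul_mem (pow_mem h 2) hy)

/-! ### Comparison of `A` with its dual -/

section Torus

variable {m : ℕ} {d : Fin (m + 1) → ℕ} {t : Fin (m + 1) → ℂ}

lemma snd_mem_ratSpan {y : ℝ} (ht : ∀ j, t j ∈ ratSpan y) {x : ℂ × (Fin (m + 1) → ℂ)}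
    (hx : x ∈ latticeA d t) (j : Fin (m + 1)) : x.2 j ∈ ratSpan y := by
  obtain ⟨p, k, -, h⟩ := mem_latticeA.1 hx
  obtain ⟨q, r, h⟩ := h j
  rw [h]
  refine sub_mem (add_mem (intCast_mul_mem_ratSpan q (ht j))
    (intCast_mul_mem_ratSpan r (natCast_mem_ratSpan y _))) (intCast_mul_mem_ratSpan k ?_)
  by_cases hj : j = Fin.last m
  · subst hj
    simpa using natCast_mem_ratSpan y 1
  · simp [hj]

lemma fst_mem_ratSpan {x : ℂ × (Fin (m + 1) → ℂ)} (hx : x ∈ latticeA d t) :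
    x.1 ∈ ratSpan Real.pi := by
  obtain ⟨p, k, h, -⟩ := mem_latticeA.1 hx
  rw [h]
  refine add_mem (intCast_mul_mem_ratSpan p ?_) (intCast_mem_ratSpan _ k)
  have : (d (Fin.last m) : ℝ) * Real.pi / Real.pi = d (Fin.last m) :=
    mul_div_cancel_right₀ _ Real.pi_ne_zero
  simp [mem_ratSpan, this]

lemma period_mem_latticeA :
    ((d (Fin.last m) : ℂ) * (Real.pi * Complex.I), (0 : Fin (m + 1) → ℂ)) ∈ latticeA d t :=
  mem_latticeA.2 ⟨1, 0, by simp, fun j => ⟨0, 0, by simp⟩⟩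

lemma one_mem_latticeA :
    ((1 : ℂ), (-Pi.single (Fin.last m) 1 : Fin (m + 1) → ℂ)) ∈ latticeA d t :=
  mem_latticeA.2 ⟨0, 1, by simp, fun j => ⟨0, 0, by simp⟩⟩

/-- The torus `A` is not isomorphic to its dual. -/
theorem not_torusIso_dual (hd : ∀ j, 0 < d j) (hN : 1 < d (Fin.last m)) (ht : ∀ j, 0 < (t j).im)
    {y : ℝ} (hy0 : y ≠ 0) (hy : y ^ 2 ∈ ratField) (hty : ∀ j, t j ∈ ratSpan y) :
    ¬ TorusIso (latticeA d t) (dualLattice (latticeA d t)) := by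
  rintro ⟨f, -, hf⟩
  have S := isSymplecticFrame_formA hd ht (hd (Fin.last m))
  have hdisc : DiscreteTopology (latticeA d t) := by
    rw [latticeA_eq_closure]
    exact S.isFullLattice.1
  obtain ⟨L, hL⟩ := hf.exists_lift hdisc
  have hmem (l : (ℂ × (Fin (m + 1) → ℂ)) →L⋆[ℂ] ℂ) :
      L l ∈ latticeA d t ↔ l ∈ dualLattice (latticeA d t) := by
    rw [← QuotientAddGroup.eq_zero_iff, ← hL, ← QuotientAddGroup.eq_zero_iff]
    exact f.symm.map_eq_zero_iff
  set N := d (Fin.last m) with hNdef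
  have hN0 : (N : ℝ) ≠ 0 := by exact_mod_cast (hd _).ne'
  have hNc : (N : ℂ) ≠ 0 := by exact_mod_cast (hd _).ne'
  have hpi : (Real.pi : ℂ) ≠ 0 := by exact_mod_cast Real.pi_ne_zero
  set a : ℂ := (N : ℂ) * (Real.pi * Complex.I) with ha
  have hsmul (z : ℂ) : L (formA (N * Real.pi) t (z, 0)) =
      z • L (formA (N * Real.pi) t (1, 0)) := by
    rw [← map_smul, ← map_smul, Prod.smul_mk, smul_zero, smul_eq_mul, mul_one]
  have happ (z : ℂ) (x : ℂ × (Fin (m + 1) → ℂ)) :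
      formA (N * Real.pi) t (z, 0) x = z * conj x.1 / ((N * Real.pi : ℝ) : ℂ) := by
    rw [formA_apply, map_zero]
    simp
  -- The forms `H((z, 0), ·)` depend only on the first coordinate: they span the curve dual to `A →
  -- E/⟨P⟩`. Both `z = 1` and `z = a` give elements of the dual lattice, so `w` and `a • w` are in
  -- the lattice of `A`.
  set w := L (formA (N * Real.pi) t (1, 0)) with hw
  have hw1 : w ∈ latticeA d t := by
    rw [hw, hmem]
    intro x hx
    obtain ⟨p, k, h, -⟩ := mem_latticeA.1 hx
    refine ⟨-p, ?_⟩
    rw [happ, h, ← hNdef, Complex.div_ofReal_im]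
    simp
    field_simp
  have hwa : a • w ∈ latticeA d t := by
    rw [hw, ← hsmul, hmem]
    intro x hx
    obtain ⟨p, k, h, -⟩ := mem_latticeA.1 hx
    refine ⟨k, ?_⟩
    rw [happ, h, ← hNdef, Complex.div_ofReal_im]
    simp [ha]
    field_simp
  -- No homomorphism to `B`: both `w.2 j` and `Nπi · w.2 j` lie in `ℚ + ℚyi`.
  have hsnd (j : Fin (m + 1)) : w.2 j = 0 := by
    obtain ⟨h1, h2⟩ := snd_mem_ratSpan hty hw1 j
    obtain ⟨h3, h4⟩ := snd_mem_ratSpan hty hwa j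
    have e3 : ((a • w).2 j).re = -(N * ((w.2 j).im * Real.pi)) := by
      simp [ha]; ring
    have e4 : ((a • w).2 j).im / y = N * ((w.2 j).re * Real.pi / y) := by
      simp [ha]; ring
    rw [e3, neg_mem_iff] at h3
    rw [e4] at h4
    have h5 := div_mem h3 (natCast_mem ratField N)
    have h6 := div_mem h4 (natCast_mem ratField N)
    rw [mul_div_cancel_left₀ _ hN0] at h5 h6
    exact Complex.ext (eq_zero_of_mul_pi_div_mem hy hy0 h1 h6) (eq_zero_of_mul_pi_mem hy hy0 h2 h5)
  obtain ⟨r, k, hr, hk⟩ := mem_latticeA.1 hw1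
  -- No complex multiplication on `E`: otherwise `a • w` has a real part that is a nonzero rational
  -- multiple of `π²`.
  have hr0 : r = 0 := by
    obtain ⟨h1, -⟩ := fst_mem_ratSpan hwa
    have e1 : ((a • w).1).re = -((r * N ^ 2 : ℝ) * Real.pi ^ 2) := by
      simp [hr]; simp [ha]; ring
    rw [e1, neg_mem_iff] at h1
    have := eq_zero_of_mul_pi_sq_mem
      (mul_mem (intCast_mem ratField r) (pow_mem (natCast_mem ratField N) 2)) h1
    simpa [hN0] using this
  obtain ⟨q, s, hqs⟩ := hk (Fin.last m)
  rw [hsnd, Pi.single_eq_same, mul_one] at hqs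
  have hq : q = 0 := by
    have := congrArg Complex.im hqs
    simpa [(ht (Fin.last m)).ne'] using this
  have hkN : k = s * N := by
    rw [hq] at hqs
    have h1 : (k : ℂ) = s * N := by
      linear_combination hqs
    exact_mod_cast h1
  have hwk : w = ((k : ℂ), 0) := Prod.ext (by simp [hr, hr0]) (funext hsnd)
  -- If `k = 0`, then `L` kills the form with `z = 1/2`, which is not in the dual lattice.
  have hk0 : k ≠ 0 := by
    intro h0
    have h1 : L (formA (N * Real.pi) t (1 / 2, 0)) ∈ latticeA d t := by
      rw [hsmul, hwk, h0, Int.cast_zero, ← Prod.zero_eq_mk, smul_zero]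
      exact zero_mem _
    obtain ⟨c, hc⟩ := (hmem _).1 h1 _ period_mem_latticeA
    have e : 1 / 2 * conj a / ((N * Real.pi : ℝ) : ℂ) = ((-(1 / 2) : ℝ) : ℂ) * Complex.I := by
      rw [ha, map_mul, map_mul, Complex.conj_natCast, Complex.conj_ofReal, Complex.conj_I]
      push_cast
      field_simp
    rw [happ, e, Complex.im_ofReal_mul, Complex.I_im, mul_one, neg_eq_iff_eq_neg,
      div_eq_iff two_ne_zero] at hc
    have h2 : (1 : ℤ) = -c * 2 := by exact_mod_cast hc
    omega
  have hkc : (k : ℂ) ≠ 0 := by exact_mod_cast hk0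
  -- The period `(a, 0)` pulls back to the form with `z = a / k`, whose imaginary part at `(1, -eₙ)`
  -- is `1 / k`. Integrality makes `k` a unit, against `N ∣ k`.
  have h1 : L (formA (N * Real.pi) t (a / k, 0)) ∈ latticeA d t := by
    rw [hsmul, hwk, Prod.smul_mk, smul_zero, smul_eq_mul, div_mul_cancel₀ _ hkc]
    exact period_mem_latticeA
  obtain ⟨c, hc⟩ := (hmem _).1 h1 _ one_mem_latticeA
  have e : a / k * conj (1 : ℂ) / ((N * Real.pi : ℝ) : ℂ) = ((1 / k : ℝ) : ℂ) * Complex.I := by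
    rw [ha, map_one]
    push_cast
    field_simp
  rw [happ, e, Complex.im_ofReal_mul, Complex.I_im, mul_one,
    div_eq_iff (by exact_mod_cast hk0)] at hc
  have h2 : (1 : ℤ) = c * k := by exact_mod_cast hc
  have h3 : (N : ℤ) ∣ 1 := ⟨c * s, by rw [h2, hkN]; ring⟩
  have h4 := Int.le_of_dvd one_pos h3
  omega

end Torus

end

noncomputable section

/-! ### The Picard number of `A` -/

/-- The quotient is torsion, so it has rank zero. -/
lemma finrank_eq_of_forall_exists_smul_mem {X : Type*} [AddCommGroup X] (N : Submodule ℤ X)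
    (h : ∀ x : X, ∃ n : ℤ, n ≠ 0 ∧ n • x ∈ N) :
    Module.finrank ℤ N = Module.finrank ℤ X := by
  have h0 : Module.rank ℤ (X ⧸ N) = 0 := by
    rw [rank_eq_zero_iff]
    intro x
    induction x using Submodule.Quotient.induction_on with | H x => ?_
    obtain ⟨n, hn, hx⟩ := h x
    exact ⟨n, hn, by rwa [← Submodule.Quotient.mk_smul, Submodule.Quotient.mk_eq_zero]⟩
  have h1 := rank_quotient_add_rank_of_isDomain N
  rw [h0, zero_add] at h1
  rw [Module.finrank, Module.finrank, h1]

section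

variable {V : Type*} [NormedAddCommGroup V] [NormedSpace ℂ V]

/-- A form that is rational on a finite set has an integral multiple on the generated group. -/
lemma exists_smul_integral {s : Set V} (hs : s.Finite) (H : V →L[ℂ] V →L⋆[ℂ] ℂ)
    (h : ∀ x ∈ s, ∀ y ∈ s, (H x y).im ∈ ratField) :
    ∃ n : ℤ, n ≠ 0 ∧ ∀ x ∈ AddSubgroup.closure s, ∀ y ∈ AddSubgroup.closure s,
      ∃ k : ℤ, ((n • H) x y).im = k := by
  choose! q hq using h
  let n : ℕ := ∏ p ∈ hs.toFinset ×ˢ hs.toFinset, (q p.1 p.2).den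
  have hn : n ≠ 0 := Finset.prod_ne_zero_iff.2 fun p _ => (q p.1 p.2).den_nz
  have key : ∀ x ∈ s, ∀ y ∈ s, ∃ k : ℤ, (((n : ℤ) • H) x y).im = k := by
    intro x hx y hy
    obtain ⟨c, hc⟩ : (q x y).den ∣ n := Finset.dvd_prod_of_mem (fun p : V × V => (q p.1 p.2).den)
      (Finset.mk_mem_product (hs.mem_toFinset.2 hx) (hs.mem_toFinset.2 hy))
    refine ⟨(q x y).num * c, ?_⟩
    have h1 : ((q x y : ℚ) : ℝ) = (H x y).im := hq x hx y hy
    have h2 : ((q x y : ℚ) : ℝ) * (q x y).den = (q x y).num := by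
      exact_mod_cast Rat.mul_den_eq_num (q x y)
    have h3 : (((n : ℤ) • H) x y).im = n * (H x y).im := by
      simp
    rw [h3, ← h1, hc]
    push_cast
    rw [← h2]
    ring
  refine ⟨n, by exact_mod_cast hn, fun x hx y hy => ?_⟩
  induction hx, hy using AddSubgroup.closure_induction₂ with
  | mem x y hx hy => exact key x hx y hy
  | zero_left x hx => exact ⟨0, by simp⟩
  | zero_right x hx => exact ⟨0, by simp⟩
  | add_left x y z _ _ _ h1 h2 =>
    obtain ⟨k, hk⟩ := h1
    obtain ⟨k', hk'⟩ := h2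
    exact ⟨k + k', by rw [map_add, add_apply, Complex.add_im, hk, hk', Int.cast_add]⟩
  | add_right x y z _ _ _ h1 h2 =>
    obtain ⟨k, hk⟩ := h1
    obtain ⟨k', hk'⟩ := h2
    exact ⟨k + k', by rw [map_add, Complex.add_im, hk, hk', Int.cast_add]⟩
  | neg_left x y _ _ h1 =>
    obtain ⟨k, hk⟩ := h1
    exact ⟨-k, by rw [map_neg, neg_apply, Complex.neg_im, hk, Int.cast_neg]⟩
  | neg_right x y _ _ h1 =>
    obtain ⟨k, hk⟩ := h1
    exact ⟨-k, by rw [map_neg, Complex.neg_im, hk, Int.cast_neg]⟩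

end

section Picard

variable {ι : Type*} [Fintype ι]

/-- Coefficient of a rational Hermitian form on a power of a curve with period in `ℚ + ℚ y i`. -/
def hermCoeff (y : ℝ) (a b : ℚ) : ℂ := ⟨((a + b : ℚ) : ℝ) / y, ((a - b : ℚ) : ℝ)⟩

lemma hermCoeff_add (y : ℝ) (a b a' b' : ℚ) :
    hermCoeff y (a + a') (b + b') = hermCoeff y a b + hermCoeff y a' b' := by
  apply Complex.ext <;> (simp [hermCoeff]; ring)

/-- Hermitian symmetry is thus automatic for an arbitrary rational matrix `R`: its symmetric part
gives the real parts of the coefficients, its antisymmetric part the imaginary ones. -/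
lemma conj_hermCoeff (y : ℝ) (a b : ℚ) : conj (hermCoeff y a b) = hermCoeff y b a := by
  apply Complex.ext
  · simp [hermCoeff, add_comm]
  · simp [hermCoeff]

/-- The forms `q z z̄' / π + ∑ hᵢⱼ vᵢ v̄'ⱼ`, where `hᵢⱼ = hermCoeff y Rᵢⱼ Rⱼᵢ`. -/
def ratForm (y : ℝ) : (ℚ × (ι → ι → ℚ)) →+ (ℂ × (ι → ℂ)) →L[ℂ] (ℂ × (ι → ℂ)) →L⋆[ℂ] ℂ where
  toFun x := ((x.1 : ℂ) / Real.pi) •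
      sesqProd (ContinuousLinearMap.fst ℂ ℂ (ι → ℂ)) (ContinuousLinearMap.fst ℂ ℂ (ι → ℂ)) +
    ∑ i, ∑ j, hermCoeff y (x.2 i j) (x.2 j i) •
      sesqProd ((ContinuousLinearMap.proj i).comp (ContinuousLinearMap.snd ℂ ℂ (ι → ℂ)))
        ((ContinuousLinearMap.proj j).comp (ContinuousLinearMap.snd ℂ ℂ (ι → ℂ)))
  map_zero' := by
    have : hermCoeff y 0 0 = 0 := by apply Complex.ext <;> simp [hermCoeff]
    refine ContinuousLinearMap.ext fun v => ContinuousLinearMap.ext fun w => ?_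
    simp [this]
  map_add' x x' := by
    refine ContinuousLinearMap.ext fun v => ContinuousLinearMap.ext fun w => ?_
    simp only [Prod.fst_add, Prod.snd_add, Pi.add_apply, hermCoeff_add, add_apply, sum_apply,
      smul_apply, smul_eq_mul, add_mul, Finset.sum_add_distrib, Rat.cast_add, add_div]
    ring

lemma ratForm_apply (y : ℝ) (x : ℚ × (ι → ι → ℚ)) (v w : ℂ × (ι → ℂ)) :
    ratForm y x v w = x.1 / Real.pi * (v.1 * conj w.1) +
      ∑ i, ∑ j, hermCoeff y (x.2 i j) (x.2 j i) * (v.2 i * conj (w.2 j)) := by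
  simp [ratForm]

lemma ratForm_hermitian (y : ℝ) (x : ℚ × (ι → ι → ℚ)) (v w : ℂ × (ι → ℂ)) :
    ratForm y x w v = conj (ratForm y x v w) := by
  rw [ratForm_apply, ratForm_apply, Finset.sum_comm]
  simp [conj_hermCoeff, mul_comm]

variable [DecidableEq ι] in
lemma ratForm_single (y : ℝ) (x : ℚ × (ι → ι → ℚ)) (i j : ι) :
    ratForm y x (0, Pi.single i 1) (0, Pi.single j 1) = hermCoeff y (x.2 i j) (x.2 j i) := by
  rw [ratForm_apply, Finset.sum_eq_single i, Finset.sum_eq_single j]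
  · simp
  · intro b _ hb
    simp [hb]
  · simp
  · intro b _ hb
    simp [hb]
  · simp

variable [DecidableEq ι] in
lemma ratForm_injective {y : ℝ} (hy : y ≠ 0) :
    Function.Injective (ratForm (ι := ι) y) := by
  rw [injective_iff_map_eq_zero]
  intro x hx
  have h (v w : ℂ × (ι → ℂ)) : ratForm y x v w = 0 := by rw [hx]; simp
  refine Prod.ext ?_ (funext fun i => funext fun j => ?_)
  · have h1 := h (1, 0) (1, 0)
    simpa [ratForm_apply, Real.pi_ne_zero] using h1
  · have h1 := h (0, Pi.single i 1) (0, Pi.single j 1)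
    rw [ratForm_single] at h1
    have hre := congrArg Complex.re h1
    have him := congrArg Complex.im h1
    simp only [hermCoeff, Complex.zero_re, Complex.zero_im, div_eq_zero_iff, hy, or_false,
      Rat.cast_eq_zero] at hre him
    change x.2 i j = 0
    linarith

variable [DecidableEq ι] in
lemma form_ext {H H' : (ℂ × (ι → ℂ)) →L[ℂ] (ℂ × (ι → ℂ)) →L⋆[ℂ] ℂ}
    (h : ∀ v w, H w v = conj (H v w)) (h' : ∀ v w, H' w v = conj (H' v w))
    (h1 : H (1, 0) (1, 0) = H' (1, 0) (1, 0))
    (h2 : ∀ j, H (1, 0) (0, Pi.single j 1) = H' (1, 0) (0, Pi.single j 1))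
    (h3 : ∀ i j, H (0, Pi.single i 1) (0, Pi.single j 1) =
      H' (0, Pi.single i 1) (0, Pi.single j 1)) : H = H' := by
  have hdec (v : ℂ × (ι → ℂ)) : v = v.1 • ((1 : ℂ), (0 : ι → ℂ)) +
      ∑ j, v.2 j • ((0 : ℂ), (Pi.single j 1 : ι → ℂ)) := by
    refine Prod.ext (by simp [Prod.fst_sum]) (funext fun j => ?_)
    rw [Prod.snd_add, Prod.snd_sum, Pi.add_apply, Finset.sum_apply, Finset.sum_eq_single j]
    · simp
    · intro b _ hb
      simp [hb.symm]
    · simp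
  have h4 (j : ι) : H (0, Pi.single j 1) (1, 0) = H' (0, Pi.single j 1) (1, 0) := by
    rw [h (1, 0), h' (1, 0), h2]
  refine ContinuousLinearMap.ext fun v => ContinuousLinearMap.ext fun w => ?_
  rw [hdec v, hdec w]
  simp only [map_add, map_sum, map_smul, map_smulₛₗ, add_apply, sum_apply, smul_apply, h1, h2, h3,
    h4]

/-- A rational form takes rational values on vectors with coordinates in `ℚ + ℚ π i` and
`ℚ + ℚ y i`. -/
lemma im_ratForm_mem {y : ℝ} (hy0 : y ≠ 0) (hy : y ^ 2 ∈ ratField) (x : ℚ × (ι → ι → ℚ))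
    {v w : ℂ × (ι → ℂ)} (hv : v.1 ∈ ratSpan Real.pi) (hw : w.1 ∈ ratSpan Real.pi)
    (hv' : ∀ i, v.2 i ∈ ratSpan y) (hw' : ∀ i, w.2 i ∈ ratSpan y) :
    (ratForm y x v w).im ∈ ratField := by
  rw [ratForm_apply, Complex.add_im, Complex.im_sum]
  refine add_mem ?_ (sum_mem fun i _ => ?_)
  · have e : ((x.1 : ℂ) / Real.pi * (v.1 * conj w.1)).im =
        x.1 * (v.1.im / Real.pi * w.1.re - v.1.re * (w.1.im / Real.pi)) := by
      have e1 : (x.1 : ℂ) / Real.pi = ((x.1 / Real.pi : ℝ) : ℂ) := by push_cast; rfl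
      rw [e1, Complex.im_ofReal_mul]
      simp
      ring
    rw [e]
    exact mul_mem ⟨x.1, rfl⟩ (sub_mem (mul_mem hv.2 hw.1) (mul_mem hv.1 hw.2))
  · rw [Complex.im_sum]
    refine sum_mem fun j _ => ?_
    have e (a b : ℚ) (z z' : ℂ) : (hermCoeff y a b * (z * conj z')).im =
        ((a + b : ℚ) : ℝ) * (z.im / y * z'.re - z.re * (z'.im / y)) +
          ((a - b : ℚ) : ℝ) * (z.re * z'.re + y ^ 2 * (z.im / y) * (z'.im / y)) := by
      simp only [hermCoeff, Complex.mul_im, Complex.mul_re, Complex.conj_re, Complex.conj_im]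
      field_simp
      ring
    rw [e]
    obtain ⟨h1, h2⟩ := hv' i
    obtain ⟨h3, h4⟩ := hw' j
    exact add_mem (mul_mem ⟨_, rfl⟩ (sub_mem (mul_mem h2 h3) (mul_mem h1 h4)))
      (mul_mem ⟨_, rfl⟩ (add_mem (mul_mem h1 h3) (mul_mem (mul_mem hy h2) h4)))

end Picard

/-! ### Néron–Severi classes of `A` as rational forms -/

section Torus

variable {m : ℕ} {d : Fin (m + 1) → ℕ} {t : Fin (m + 1) → ℂ}

lemma natCast_mem_latticeA :
    ((d (Fin.last m) : ℂ), (0 : Fin (m + 1) → ℂ)) ∈ latticeA d t := by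
  refine mem_latticeA.2 ⟨0, d (Fin.last m), by simp, fun j => ?_⟩
  by_cases h : j = Fin.last m
  · subst h
    exact ⟨0, 1, by simp⟩
  · exact ⟨0, 0, by simp [h]⟩

lemma single_period_mem_latticeA (i : Fin (m + 1)) :
    ((0 : ℂ), (Pi.single i (t i) : Fin (m + 1) → ℂ)) ∈ latticeA d t := by
  refine mem_latticeA.2 ⟨0, 0, by simp, fun j => ?_⟩
  by_cases h : j = i
  · subst h
    exact ⟨1, 0, by simp⟩
  · exact ⟨0, 0, by simp [h]⟩

lemma single_natCast_mem_latticeA (i : Fin (m + 1)) :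
    ((0 : ℂ), (Pi.single i (d i : ℂ) : Fin (m + 1) → ℂ)) ∈ latticeA d t := by
  refine mem_latticeA.2 ⟨0, 0, by simp, fun j => ?_⟩
  by_cases h : j = i
  · subst h
    exact ⟨0, 1, by simp⟩
  · exact ⟨0, 0, by simp [h]⟩

/-- The periods of `E` and of the factors of `B` already lie in the lattice of `A`; integrality of
`Im H` on pairs of them determines the shape of `H`. -/
lemma exists_ratForm_eq (hd : ∀ j, 0 < d j) (ht : ∀ j, 0 < (t j).im)
    {y : ℝ} (hy0 : y ≠ 0) (hy : y ^ 2 ∈ ratField) (hty : ∀ j, t j ∈ ratSpan y)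
    {H : (ℂ × (Fin (m + 1) → ℂ)) →L[ℂ] (ℂ × (Fin (m + 1) → ℂ)) →L⋆[ℂ] ℂ}
    (hH : H ∈ neronSeveri (latticeA d t)) : ∃ x, ratForm y x = H := by
  have hfst (z : ℂ) : (z, (0 : Fin (m + 1) → ℂ)) = z • (1, 0) := by simp
  have hsnd (j : Fin (m + 1)) (z : ℂ) : ((0 : ℂ), (Pi.single j z : Fin (m + 1) → ℂ)) =
      z • (0, Pi.single j 1) := by
    rw [Prod.smul_mk, smul_zero, ← Pi.single_smul, smul_eq_mul, mul_one]
  have him {v w : ℂ × (Fin (m + 1) → ℂ)} (hv : v ∈ latticeA d t) (hw : w ∈ latticeA d t) :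
      (H v w).im ∈ ratField := by
    obtain ⟨k, hk⟩ := hH.2 v hv w hw
    rw [hk]
    exact intCast_mem _ _
  have hdiv (z : ℂ) (j : Fin (m + 1)) (h1 : z.im ∈ ratField)
      (h2 : (conj (t j) * z).im ∈ ratField) : y * z.re ∈ ratField := by
    obtain ⟨ha, hb⟩ := hty j
    have hb0 : (t j).im / y ≠ 0 := div_ne_zero (ht j).ne' hy0
    have e : y * z.re = ((t j).re * z.im - (conj (t j) * z).im) / ((t j).im / y) := by
      have := (ht j).ne'
      simp
      field_simp
    rw [e]
    exact div_mem (sub_mem (mul_mem ha h1) h2) hb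
  have hcancel {n : ℕ} (hn : 0 < n) {r : ℝ} (h : n * r ∈ ratField) : r ∈ ratField := by
    have hn' : (n : ℝ) ≠ 0 := by exact_mod_cast hn.ne'
    rw [← mul_div_cancel_left₀ r hn']
    exact div_mem h (natCast_mem _ _)
  have hnat (n : ℕ) (z : ℂ) : ((n : ℂ) * z).im = n * z.im := by simp
  have hnatre (n : ℕ) (z : ℂ) : ((n : ℂ) * z).re = n * z.re := by simp
  have hper (n : ℕ) (z : ℂ) : ((n : ℂ) * (Real.pi * Complex.I) * z).im = n * (z.re * Real.pi) := by
    rw [mul_assoc, hnat]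
    simp [mul_comm]
  have hN := hd (Fin.last m)
  obtain ⟨q, hq⟩ : (H (1, 0) (1, 0)).re * Real.pi ∈ ratField := by
    have h1 := him (period_mem_latticeA (d := d) (t := t)) natCast_mem_latticeA
    rw [hfst, hfst (d (Fin.last m))] at h1
    simp only [map_smul, map_smulₛₗ, smul_apply, smul_eq_mul, Complex.conj_natCast] at h1
    rw [hnat, hper] at h1
    exact hcancel hN (hcancel hN h1)
  -- Pairing two periods of `E` with two of the `j`-th curve makes `Im h` and `y Re h` rational, and
  -- also `π Re h` and `π Re(t̄ⱼ h)`. The last two conditions successively force `Re h = 0` and `Im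
  -- h = 0`.
  have hcross (j : Fin (m + 1)) : H (1, 0) (0, Pi.single j 1) = 0 := by
    set h := H (1, 0) (0, Pi.single j 1) with hh
    have e (z z' : ℂ) : H (z, 0) (0, Pi.single j z') = z * (conj z' * h) := by
      rw [hfst, hsnd, hh]
      simp only [map_smul, map_smulₛₗ, smul_apply, smul_eq_mul]
      ring
    have h1 := him (natCast_mem_latticeA (d := d) (t := t)) (single_natCast_mem_latticeA j)
    have h2 := him (period_mem_latticeA (d := d) (t := t)) (single_natCast_mem_latticeA j)
    have h3 := him (natCast_mem_latticeA (d := d) (t := t)) (single_period_mem_latticeA j)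
    have h4 := him (period_mem_latticeA (d := d) (t := t)) (single_period_mem_latticeA j)
    rw [e, Complex.conj_natCast, hnat, hnat] at h1
    rw [e, Complex.conj_natCast, hper] at h2
    rw [e, hnat] at h3
    rw [e, hper] at h4
    have h2' := hcancel hN h2
    rw [hnatre, mul_assoc] at h2'
    have hre : h.re = 0 := by
      have h5 := eq_zero_of_mul_pi_div_mem hy hy0
        (hdiv h j (hcancel (hd j) (hcancel hN h1)) (hcancel hN h3))
        (by rw [mul_assoc, mul_div_cancel_left₀ _ hy0]; exact hcancel (hd j) h2')
      simpa [hy0] using h5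
    have hcr : (conj (t j) * h).re = (t j).im * h.im := by simp [hre]
    have him0 : h.im = 0 := by
      rw [hcr] at h4
      have h5 := eq_zero_of_mul_pi_mem hy hy0
        (by rw [mul_div_right_comm]
            exact mul_mem (hty j).2 (hcancel (hd j) (hcancel hN h1))) (hcancel hN h4)
      simpa [(ht j).ne'] using h5
    exact Complex.ext hre him0
  have hentry (i j : Fin (m + 1)) :
      (H (0, Pi.single i 1) (0, Pi.single j 1)).im ∈ ratField ∧
        y * (H (0, Pi.single i 1) (0, Pi.single j 1)).re ∈ ratField := by
    have e (z z' : ℂ) : H (0, Pi.single i z) (0, Pi.single j z') =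
        z * (conj z' * H (0, Pi.single i 1) (0, Pi.single j 1)) := by
      rw [hsnd i z, hsnd j z']
      simp only [map_smul, map_smulₛₗ, smul_apply, smul_eq_mul]
      ring
    have h1 := him (single_natCast_mem_latticeA (t := t) i) (single_natCast_mem_latticeA (t := t) j)
    have h2 := him (single_natCast_mem_latticeA (t := t) i) (single_period_mem_latticeA (t := t) j)
    rw [e, Complex.conj_natCast, hnat, hnat] at h1
    rw [e, hnat] at h2
    have h1' := hcancel (hd j) (hcancel (hd i) h1)
    exact ⟨h1', hdiv _ j h1' (hcancel (hd i) h2)⟩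
  choose u hu using fun i j => mem_ratField.1 (hentry i j).1
  choose s hs using fun i j => mem_ratField.1 (hentry i j).2
  have hsymm (i j : Fin (m + 1)) : s j i = s i j := by
    have h1 : (s j i : ℝ) = s i j := by
      rw [hs, hs, hH.1 (0, Pi.single i 1), Complex.conj_re]
    exact_mod_cast h1
  have hanti (i j : Fin (m + 1)) : u j i = -u i j := by
    have h1 : (u j i : ℝ) = -u i j := by
      rw [hu, hu, hH.1 (0, Pi.single i 1), Complex.conj_im]
    exact_mod_cast h1
  -- Solves `Rᵢⱼ + Rⱼᵢ = sᵢⱼ`, `Rᵢⱼ - Rⱼᵢ = uᵢⱼ`, using that `s` is symmetric and `u` antisymmetric.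
  refine ⟨(q, fun i j => (s i j + u i j) / 2), form_ext (ratForm_hermitian y _) hH.1 ?_ ?_ ?_⟩
  · have h0 : (H (1, 0) (1, 0)).im = 0 := Complex.conj_eq_iff_im.1 (hH.1 (1, 0) (1, 0)).symm
    rw [ratForm_apply]
    have e : (q : ℂ) / Real.pi = ((H (1, 0) (1, 0)).re : ℂ) := by
      rw [← mul_div_cancel_right₀ (H (1, 0) (1, 0)).re Real.pi_ne_zero, ← hq]
      push_cast
      rfl
    simp only [e]
    apply Complex.ext
    · simp
    · simp [h0]
  · intro j
    rw [hcross, ratForm_apply]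
    simp
  · intro i j
    rw [ratForm_single]
    simp only [hsymm i j, hanti i j]
    apply Complex.ext
    · simp only [hermCoeff]
      rw [div_eq_iff hy0, mul_comm, ← hs]
      push_cast
      ring
    · simp only [hermCoeff]
      rw [← hu]
      push_cast
      ring

/-- Through the injection `ratForm`, the Néron–Severi group becomes a subgroup of a rational vector
space that meets every line, so its rank is the dimension of that space. -/
theorem picardNumber_latticeA (hd : ∀ j, 0 < d j) (ht : ∀ j, 0 < (t j).im)
    {y : ℝ} (hy0 : y ≠ 0) (hy : y ^ 2 ∈ ratField) (hty : ∀ j, t j ∈ ratSpan y) :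
    picardNumber (latticeA d t) = (m + 1) ^ 2 + 1 := by
  let N : AddSubgroup (ℚ × (Fin (m + 1) → Fin (m + 1) → ℚ)) :=
    (neronSeveri (latticeA d t)).comap (ratForm y)
  have hbij : Function.Bijective (AddMonoidHom.addSubgroupComap (ratForm y)
      (neronSeveri (latticeA d t))) := by
    constructor
    · intro a b hab
      exact Subtype.ext (ratForm_injective hy0 (congrArg Subtype.val hab))
    · rintro ⟨H, hH⟩
      obtain ⟨x, rfl⟩ := exists_ratForm_eq hd ht hy0 hy hty hH
      exact ⟨⟨x, hH⟩, rfl⟩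
  have e := (AddEquiv.ofBijective _ hbij).toIntLinearEquiv.finrank_eq
  rw [picardNumber, ← e]
  have h1 : Module.finrank ℤ (AddSubgroup.toIntSubmodule N) =
      Module.finrank ℤ (ℚ × (Fin (m + 1) → Fin (m + 1) → ℚ)) := by
    refine finrank_eq_of_forall_exists_smul_mem _ fun x => ?_
    have hfin : (Set.range (frameLeft (d (Fin.last m) * (Real.pi * Complex.I)) t) ∪
      Set.range (frameRight d)).Finite := (Set.finite_range _).union (Set.finite_range _)
    obtain ⟨n, hn, h⟩ := exists_smul_integral hfin (ratForm y x) (fun v hv w hw => by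
      have hv' : v ∈ latticeA d t := latticeA_eq_closure ▸ AddSubgroup.subset_closure hv
      have hw' : w ∈ latticeA d t := latticeA_eq_closure ▸ AddSubgroup.subset_closure hw
      exact im_ratForm_mem hy0 hy x (fst_mem_ratSpan hv') (fst_mem_ratSpan hw')
        (snd_mem_ratSpan hty hv') (snd_mem_ratSpan hty hw'))
    rw [← latticeA_eq_closure] at h
    refine ⟨n, hn, ratForm_hermitian y _, fun v hv w hw => ?_⟩
    rw [map_zsmul]
    exact h v hv w hw
  refine Eq.trans h1 ?_
  rw [← IsFractionRing.finrank_right_eq ℤ ℚ]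
  simp [Module.finrank_prod, Module.finrank_pi_fintype]
  ring

end Torus

end

noncomputable section

/-! ### The points `P` and `Q` -/

lemma addOrderOf_eq_of_forall {G : Type*} [AddGroup G] {x : G} {n : ℕ}
    (h : ∀ k : ℕ, k • x = 0 ↔ n ∣ k) : addOrderOf x = n :=
  Nat.dvd_antisymm (addOrderOf_dvd_iff_nsmul_eq_zero.2 ((h n).2 dvd_rfl))
    ((h _).1 (addOrderOf_nsmul_eq_zero x))

lemma addOrderOf_mk_one (N : ℕ) :
    addOrderOf (QuotientAddGroup.mk 1 : ℂ ⧸ latticeE N) = N := by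
  refine addOrderOf_eq_of_forall fun k => ?_
  rw [← QuotientAddGroup.mk_nsmul, QuotientAddGroup.eq_zero_iff, latticeE, mem_planeLattice]
  constructor
  · rintro ⟨p, q, h⟩
    have hre := congrArg Complex.re h
    simp at hre
    have h1 : (k : ℤ) = q * N := by exact_mod_cast hre
    exact Int.natCast_dvd_natCast.1 ⟨q, by rw [h1, mul_comm]⟩
  · rintro ⟨q, rfl⟩
    exact ⟨0, q, by simp [mul_comm]⟩

lemma addOrderOf_mk_single {m : ℕ} {d : Fin (m + 1) → ℕ} {t : Fin (m + 1) → ℂ}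
    (ht : ∀ j, 0 < (t j).im) :
    addOrderOf (QuotientAddGroup.mk (-Pi.single (Fin.last m) 1) :
      (Fin (m + 1) → ℂ) ⧸ latticeB d t) = d (Fin.last m) := by
  refine addOrderOf_eq_of_forall fun k => ?_
  rw [← QuotientAddGroup.mk_nsmul, QuotientAddGroup.eq_zero_iff, mem_latticeB]
  constructor
  · intro h
    obtain ⟨p, q, h⟩ := h (Fin.last m)
    rw [Pi.smul_apply, Pi.neg_apply, Pi.single_eq_same, nsmul_eq_mul] at h
    have hp : p = 0 := by
      have him := congrArg Complex.im h
      simpa [(ht (Fin.last m)).ne'] using him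
    have h1 : (k : ℂ) = d (Fin.last m) * (-q : ℤ) := by
      rw [hp] at h
      push_cast
      linear_combination -h
    exact Int.natCast_dvd_natCast.1 ⟨-q, by exact_mod_cast h1⟩
  · rintro ⟨q, rfl⟩ j
    by_cases hj : j = Fin.last m
    · subst hj
      exact ⟨0, -q, by simp [mul_comm]⟩
    · exact ⟨0, 0, by simp [hj]⟩

/-! ### Integrality of the polarisations -/

lemma IsSymplecticFrame.mem_neronSeveri {V ι : Type*} [NormedAddCommGroup V] [NormedSpace ℂ V]
    [Fintype ι] [DecidableEq ι] {H : V →L[ℂ] V →L⋆[ℂ] ℂ} {d : ι → ℕ} {l m : ι → V}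
    (S : IsSymplecticFrame H d l m) :
    H ∈ neronSeveri (AddSubgroup.closure (Set.range l ∪ Set.range m)) := by
  refine ⟨S.hermitian, fun x hx => ?_⟩
  obtain ⟨p, q, rfl⟩ := (mem_closure_range_union l m x).1 hx
  rw [sum_zsmul_eq_sum_smul]
  exact (S.mem_dualLattice_iff _ _).2 fun i =>
    ⟨⟨p i * d i, by push_cast; rfl⟩, ⟨q i * d i, by push_cast; rfl⟩⟩

end

/-! ### The main theorem -/

theorem mainTheorem4 (m : ℕ) (d : Fin (m + 1) → ℕ)
    (hdvd : ∀ i j, i ≤ j → d i ∣ d j) (hd : 1 < d (Fin.last m))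
    (τF : ℂ) (hτF : 0 < τF.im) (hCM : HasCM (planeLattice τF 1))
    (t : Fin (m + 1) → ℂ) (ht : (∀ j, t j = τF) ∨ (∀ j, t j = d j * τF)) :
    -- `P` and `Q` are primitive `dₙ`-torsion points
    addOrderOf (QuotientAddGroup.mk 1 : ℂ ⧸ latticeE (d (Fin.last m))) = d (Fin.last m) ∧
    addOrderOf (QuotientAddGroup.mk (-Pi.single (Fin.last m) 1) :
      (Fin (m + 1) → ℂ) ⧸ latticeB d t) = d (Fin.last m) ∧
    -- `B` with its product polarisation, whose kernel contains `Q`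
    IsFullLattice (latticeB d t) ∧
    ∃ HB : neronSeveri (latticeB d t),
      (∀ v w, HB.1 v w = ∑ j, v j * conj (w j) / ((t j).im : ℂ)) ∧
      IsPolarisationOfType HB d ∧
      polarisingHom HB (QuotientAddGroup.mk (-Pi.single (Fin.last m) 1)) = 0 ∧
      -- `A` with the polarisation that pulls back to the product polarisation of `E × B`
      IsFullLattice (latticeA d t) ∧
      (∃ H : neronSeveri (latticeA d t),
        (∀ p q, H.1 p q =
          p.1 * conj q.1 / ((d (Fin.last m) : ℂ) * Real.pi) + HB.1 p.2 q.2) ∧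
        IsPolarisationOfType H (Fin.cons 1 d : Fin (m + 2) → ℕ) ∧
        IsBigPeriodMatrix H
          (smallPeriodMatrix ((d (Fin.last m) : ℂ) * (Real.pi * Complex.I)) t)
          (Fin.cons 1 d : Fin (m + 2) → ℕ)) ∧
      -- `A` is not isomorphic to its dual
      ¬ TorusIso (latticeA d t) (dualLattice (latticeA d t)) ∧
      -- the Picard number of `A` is `(n - 1)² + 1`
      picardNumber (latticeA d t) = (m + 1) ^ 2 + 1 := by
  -- Positivity of all `d j` follows because each divides the positive last one.
  have hdpos (j : Fin (m + 1)) : 0 < d j :=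
    Nat.pos_of_dvd_of_pos (hdvd j (Fin.last m) (Fin.le_last j)) (by omega)
  obtain ⟨x, s, hx, hs⟩ := hCM.exists_rat hτF
  have hy : τF.im ^ 2 ∈ ratField := ⟨s, hs.symm⟩
  have hτ : τF ∈ ratSpan τF.im := ⟨⟨x, hx.symm⟩, by rw [div_self hτF.ne']; exact one_mem _⟩
  have htim (j : Fin (m + 1)) : 0 < (t j).im := by
    rcases ht with ht | ht
    · rwa [ht]
    · rw [ht, ← Complex.ofReal_natCast, Complex.im_ofReal_mul]
      exact mul_pos (by exact_mod_cast hdpos j) hτF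
  have htmem (j : Fin (m + 1)) : t j ∈ ratSpan τF.im := by
    rcases ht with ht | ht
    · rwa [ht]
    · rw [ht, ← Int.cast_natCast]
      exact intCast_mul_mem_ratSpan _ hτ
  have SB := isSymplecticFrame_formB hdpos htim
  have SA := isSymplecticFrame_formA hdpos htim (hdpos (Fin.last m))
  have hB : formB t ∈ neronSeveri (latticeB d t) := by
    rw [latticeB_eq_closure]
    exact SB.mem_neronSeveri
  have hA : formA (d (Fin.last m) * Real.pi) t ∈ neronSeveri (latticeA d t) := by
    rw [latticeA_eq_closure]
    exact SA.mem_neronSeveri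
  refine ⟨addOrderOf_mk_one _, addOrderOf_mk_single htim, ?_, ⟨formB t, hB⟩, formB_apply t, ?_,
    ?_, ?_, ⟨⟨formA (d (Fin.last m) * Real.pi) t, hA⟩, fun p q => ?_, ?_, ?_⟩, ?_, ?_⟩
  · rw [latticeB_eq_closure]
    exact SB.isFullLattice
  · exact IsSymplecticFrame.isPolarisationOfType (H := ⟨formB t, hB⟩) SB latticeB_eq_closure
      (by simp) (fun v hv => formB_pos htim hv) hdvd
  · change QuotientAddGroup.mk (formB t (-Pi.single (Fin.last m) 1)) = _
    rw [QuotientAddGroup.eq_zero_iff]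
    intro v hv
    obtain ⟨p, q, h⟩ := mem_latticeB.1 hv (Fin.last m)
    refine ⟨p, ?_⟩
    have h0 := (htim (Fin.last m)).ne'
    rw [map_neg, neg_apply, formB_single_left, h, one_mul, Complex.neg_im, Complex.div_ofReal_im]
    simp
    field_simp
  · rw [latticeA_eq_closure]
    exact SA.isFullLattice
  · rw [formA_apply]
    push_cast
    rfl
  · refine IsSymplecticFrame.isPolarisationOfType (H := ⟨formA _ t, hA⟩) SA latticeA_eq_closure
      (by simp [add_comm])
      (fun v hv => formA_pos (mul_pos (by exact_mod_cast hdpos _) Real.pi_pos) htim hv) ?_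
    intro i j hij
    induction i using Fin.cases with
    | zero => simp
    | succ i =>
      induction j using Fin.cases with
      | zero => exact absurd hij (by simp)
      | succ j => simpa using hdvd i j (Fin.succ_le_succ_iff.1 hij)
  · exact isBigPeriodMatrix_formA hdpos htim rfl
  · exact not_torusIso_dual hdpos hd htim hτF.ne' hy htmem
  · exact picardNumber_latticeA hdpos htim hτF.ne' hy htmem
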